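/- Let $T\colon[0,1]\to[0,1]$ be a measurable map and let $\mu$ be a $T$-invariant Borel probability measure on $[0,1]$. Suppose that correlations decay exponentially for $L^1$ against $BV$: there are constants $c_0,\tau>0$ such that for every $f\in L^1(\mu)$, every function $g\colon[0,1]\to\mathbb R$ of bounded variation and every integer $n\ge 0$, \[ \Bigl|\int f\circ T^n\cdot g\,\mathrm d\mu-\int f\,\mathrm d\mu\int g\,\mathrm d\mu\Bigr|\le c_0e^{-\tau n}\,\|f\|_1\,\|g\|_{BV}, \] where $\|f\|_1=\int|f|\,\mathrm d\mu$ and $\|g\|_{BV}=\sup|g|+\operatorname{var} g$ with $\operatorname{var} g$ the total variation of $g$. Let $B(x,r)=\{y\in[0,1]:|y-x|<r\}$, and suppose that there are constants $c,s>0$ such that $\mu(B(x,r))\le c\,r^s$ for all $x\in[0,1]$ and all $r>0$. Let $(m_k)_{k\ge1}$ be a sequence of real numbers such that, for some $\varepsilon>0$, \[ m_k\ge\frac{(\log k)^{4+\varepsilon}}{k}\quad\text{for all sufficiently large }k, \qquad\text{and}\qquad \lim_{\rho\to1^+}\limsup_{k\to\infty}\frac{m_k}{m_{[\rho k]}}=1,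 \] where $[\cdot]$ denotes the integer part. For $k\ge1$ and $x\in[0,1]$ let $B_k(x)=B(x,r_k(x))$ be a ball with centre $x$ such that, for all sufficiently large $k$, $\mu(B_k(x))=m_k$ for every $x\in[0,1]$ (any choice of the radii $r_k(x)$ is allowed; for the remaining finitely many $k$ they are arbitrary). Then for $\mu$-almost every $x$, \[ \lim_{n\to\infty}\frac{\sum_{k=1}^n\mathbf 1_{B_k(x)}(T^kx)}{\sum_{k=1}^n\mu(B_k(x))}=1 . \] -/

import Mathlib

open MeasureTheory Filter Topology

noncomputable section

/-- The norm `‖g‖_BV = sup |g| + var g` of a function of bounded variation on `[0,1]`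
(only used when `g` has bounded variation, so that both terms are finite). -/
def bvNorm (g : Set.Icc (0 : ℝ) 1 → ℝ) : ℝ :=
  (⨆ x, |g x|) + (eVariationOn g Set.univ).toReal

/-- Correlations of `([0,1], T, μ)` decay exponentially for `L¹` against `BV`. -/
def ExpDecayCorrelations (T : Set.Icc (0 : ℝ) 1 → Set.Icc (0 : ℝ) 1)
    (μ : Measure (Set.Icc (0 : ℝ) 1)) : Prop :=
  ∃ c τ : ℝ, 0 < c ∧ 0 < τ ∧
    ∀ f g : Set.Icc (0 : ℝ) 1 → ℝ, Integrable f μ → BoundedVariationOn g Set.univ →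
      ∀ n : ℕ,
        |∫ x, f (T^[n] x) * g x ∂μ - (∫ x, f x ∂μ) * ∫ x, g x ∂μ|
          ≤ c * Real.exp (-τ * n) * (∫ x, |f x| ∂μ) * bvNorm g

end

/-!
The convergence follows from a second moment estimate for the number of `k ≤ n` such that `T^k x`
lies in the ball of measure `m k` around `x`.

Membership in this ball is expressed by `ballMass μ x y`, the measure of the open ball centred at
`x` with `y` on its boundary: up to ties, the point `T^k x` is in the ball of measure `m k` exactly
if `ballMass μ x (T^k x) < m k`. The growth condition on balls makes the distribution function of
`μ` Hölder continuous, so `ballMass` is continuous, changes by at most a power of `δ` when `x` moves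
by `δ` (`BallGrowth.abs_ballMass_sub_le`), and `ballMass μ x` is uniformly distributed on `[0,1]`
(`BallGrowth.measure_ballMass_le`, `BallGrowth.le_measure_ballMass_lt`). Ties are avoided by treating
the events `ballMass μ x (T^k x) < m k` and `ballMass μ x (T^k x) ≤ m k` separately: the actual event
lies between them, whatever the choice of the radii.

To compute the measure of such an event, `[0,1]` is cut into cells of length `1 / N`. On one cell
the ball around `x` may be replaced by the ball around a fixed point, which is an interval, at a cost
of a power of `1 / N`; decay of correlations, applied with the indicator of the cell as the function
of bounded variation, gives the measure of the set of points of the cell that hit this fixed target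
at time `k`, and summing over the cells costs a factor `N`. A choice of `N` growing
exponentially in `k`, at a rate below the mixing rate, makes the total error exponentially small in
`k`. For a pair of times `k < k + j`, the target on a cell is the set of points that lie in the first
ball and enter the second one after `j` steps. As decay of correlations only involves the `L¹` norm
of the function evaluated in the future, this target is as good as a ball, and its measure is found
by another application of decay of correlations. This gives `exists_isQuasiIndependent`.

The error for the pair `(k, k + j)` contains a term `exp (-γ k)` that does not decay in `j`. It is
harmless when `k` is at least a multiple of `log n`, and the fewer events before that contribute at
most `O(log n)` to the count. Hence the second moment of the centred count is at most a multiple of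
`S n + 1 + (log n) ^ 2`, where `S n = m 1 + ⋯ + m n` (`IsQuasiIndependent.exists_integral_sq_le`).
The lower bound on `m k` gives `(log n) ^ 2 = O(S n)` (`exists_log_sq_le_sum`), so that the variance
is of the order of the mean. Along the indices at which `S` passes the squares the
normalised variances are summable, which yields almost sure convergence along this subsequence, and
monotonicity fills the gaps (`ae_tendsto_sum_indicator_div`).
-/

noncomputable section

/-! ### Intervals as test functions for the decay of correlations -/

theorem eVariationOn_univ_le_one_of_monotone {f : Set.Icc (0 : ℝ) 1 → ℝ} (hf : Monotone f)
    (h0 : ∀ x, 0 ≤ f x) (h1 : ∀ x, f x ≤ 1) : eVariationOn f Set.univ ≤ 1 := by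
  have h := (hf.monotoneOn Set.univ).eVariationOn_eq (a := ⊥) (b := ⊤)
    (Set.mem_univ _) (Set.mem_univ _)
  rw [Set.Icc_bot_top, Set.inter_univ] at h
  rw [h]
  exact ENNReal.ofReal_le_one.2 (by linarith [h0 ⊥, h1 ⊤])

theorem eVariationOn_univ_le_one_of_antitone {f : Set.Icc (0 : ℝ) 1 → ℝ} (hf : Antitone f)
    (h0 : ∀ x, 0 ≤ f x) (h1 : ∀ x, f x ≤ 1) : eVariationOn f Set.univ ≤ 1 := by
  have h := eVariationOn_univ_le_one_of_monotone (f := fun x => 1 - f x)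
    (fun x y hxy => sub_le_sub_left (hf hxy) 1) (fun x => by linarith [h1 x])
    (fun x => by linarith [h0 x])
  have hL : LipschitzWith 1 (fun t : ℝ => 1 - t) :=
    LipschitzWith.of_dist_le_mul fun a b => by
      rw [dist_sub_left]; simp
  have h2 := (hL.lipschitzOnWith (s := Set.univ)).comp_eVariationOn_le
    (g := fun x => 1 - f x) (s := Set.univ) (Set.mapsTo_univ _ _)
  have h3 : (fun t : ℝ => 1 - t) ∘ (fun x => 1 - f x) = f := by funext x; simp
  rw [h3] at h2
  simpa using h2.trans (by simpa using h)

open Classical in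
/-- The indicator of an interval is the product of the indicators of the two rays it spans, one
monotone and one antitone, so its variation is at most two. -/
theorem eVariationOn_indicator_le_two {J : Set (Set.Icc (0 : ℝ) 1)} (hJ : J.OrdConnected) :
    eVariationOn (J.indicator fun _ => (1 : ℝ)) Set.univ ≤ 2 := by
  set u : Set.Icc (0 : ℝ) 1 → ℝ := fun x => if ∃ a ∈ J, a ≤ x then 1 else 0 with hu
  set l : Set.Icc (0 : ℝ) 1 → ℝ := fun x => if ∃ a ∈ J, x ≤ a then 1 else 0 with hl
  have hmul : J.indicator (fun _ => (1 : ℝ)) = u * l := by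
    funext x
    by_cases hx : x ∈ J
    · have h1 : ∃ a ∈ J, a ≤ x := ⟨x, hx, le_rfl⟩
      have h2 : ∃ a ∈ J, x ≤ a := ⟨x, hx, le_rfl⟩
      simp only [Pi.mul_apply, hu, hl, if_pos h1, if_pos h2, Set.indicator_of_mem hx, mul_one]
    · have h : ¬ ((∃ a ∈ J, a ≤ x) ∧ ∃ a ∈ J, x ≤ a) := by
        rintro ⟨⟨a, ha, hax⟩, b, hb, hxb⟩
        exact hx (hJ.out ha hb ⟨hax, hxb⟩)
      simp only [Pi.mul_apply, hu, hl, Set.indicator_of_notMem hx]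
      split_ifs <;> simp_all
  have hu0 : ∀ x, 0 ≤ u x := fun x => by simp only [hu]; split_ifs <;> norm_num
  have hu1 : ∀ x, u x ≤ 1 := fun x => by simp only [hu]; split_ifs <;> norm_num
  have hl0 : ∀ x, 0 ≤ l x := fun x => by simp only [hl]; split_ifs <;> norm_num
  have hl1 : ∀ x, l x ≤ 1 := fun x => by simp only [hl]; split_ifs <;> norm_num
  have hum : Monotone u := by
    intro x y hxy
    by_cases h : ∃ a ∈ J, a ≤ x
    · obtain ⟨a, ha, hax⟩ := h
      have h' : ∃ a ∈ J, a ≤ y := ⟨a, ha, hax.trans hxy⟩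
      simpa only [hu, if_pos h'] using hu1 x
    · simpa only [hu, if_neg h] using hu0 y
  have hla : Antitone l := by
    intro x y hxy
    by_cases h : ∃ a ∈ J, y ≤ a
    · obtain ⟨a, ha, hya⟩ := h
      have h' : ∃ a ∈ J, x ≤ a := ⟨a, ha, hxy.trans hya⟩
      simpa only [hl, if_pos h'] using hl1 y
    · simpa only [hl, if_neg h] using hl0 x
  have henorm : ∀ t : ℝ, 0 ≤ t → t ≤ 1 → ‖t‖ₑ ≤ 1 := fun t h0 h1 => by
    rw [Real.enorm_of_nonneg h0]; exact ENNReal.ofReal_le_one.2 h1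
  rw [hmul]
  refine (eVariation_mul_le (C := 1) (D := 1) (fun x _ => henorm _ (hu0 x) (hu1 x))
    (fun x _ => henorm _ (hl0 x) (hl1 x))).trans ?_
  rw [one_mul, one_mul, ← one_add_one_eq_two]
  exact add_le_add (eVariationOn_univ_le_one_of_antitone hla hl0 hl1)
    (eVariationOn_univ_le_one_of_monotone hum hu0 hu1)

theorem boundedVariationOn_indicator {J : Set (Set.Icc (0 : ℝ) 1)} (hJ : J.OrdConnected) :
    BoundedVariationOn (J.indicator fun _ => (1 : ℝ)) Set.univ :=
  ne_top_of_le_ne_top (by simp) (eVariationOn_indicator_le_two hJ)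

theorem bvNorm_indicator_le_three {J : Set (Set.Icc (0 : ℝ) 1)} (hJ : J.OrdConnected) :
    bvNorm (J.indicator fun _ => (1 : ℝ)) ≤ 3 := by
  have h1 : (⨆ x, |J.indicator (fun _ => (1 : ℝ)) x|) ≤ 1 := by
    refine ciSup_le fun x => ?_
    by_cases hx : x ∈ J <;> simp [hx]
  have h2 : (eVariationOn (J.indicator fun _ => (1 : ℝ)) Set.univ).toReal ≤ 2 :=
    ENNReal.toReal_le_of_le_ofReal (by norm_num) (by simpa using eVariationOn_indicator_le_two hJ)
  rw [bvNorm]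
  linarith

/-- Exponential decay of the correlations of sets: the present event `J` is an interval, the
future event `A` is an arbitrary measurable set, and the error is proportional to `μ A`. -/
def ExpMixingSets (T : Set.Icc (0 : ℝ) 1 → Set.Icc (0 : ℝ) 1)
    (μ : Measure (Set.Icc (0 : ℝ) 1)) (c τ : ℝ) : Prop :=
  ∀ A J : Set (Set.Icc (0 : ℝ) 1), MeasurableSet A → J.OrdConnected → ∀ n : ℕ,
    |μ.real (J ∩ T^[n] ⁻¹' A) - μ.real A * μ.real J| ≤ c * Real.exp (-τ * n) * μ.real A

theorem ExpDecayCorrelations.exists_expMixingSets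
    {T : Set.Icc (0 : ℝ) 1 → Set.Icc (0 : ℝ) 1}
    {μ : Measure (Set.Icc (0 : ℝ) 1)} [IsProbabilityMeasure μ] (hT : Measurable T)
    (h : ExpDecayCorrelations T μ) :
    ∃ c τ : ℝ, 0 < c ∧ 0 < τ ∧ ExpMixingSets T μ c τ := by
  obtain ⟨c, τ, hc, hτ, h⟩ := h
  refine ⟨c * 3, τ, by positivity, hτ, fun A J hA hJ n => ?_⟩
  have hTA : MeasurableSet (T^[n] ⁻¹' A) := hT.iterate n hA
  have key := h (A.indicator fun _ => (1 : ℝ)) (J.indicator fun _ => (1 : ℝ))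
    ((integrable_const 1).indicator hA) (boundedVariationOn_indicator hJ) n
  have e1 : (fun x => A.indicator (fun _ => (1 : ℝ)) (T^[n] x) * J.indicator (fun _ => (1 : ℝ)) x)
      = (J ∩ T^[n] ⁻¹' A).indicator fun _ => (1 : ℝ) := by
    funext x
    by_cases h1 : x ∈ J <;> by_cases h2 : T^[n] x ∈ A <;> simp [h1, h2, Set.indicator]
  have e2 : (fun x => |A.indicator (fun _ => (1 : ℝ)) x|) = A.indicator fun _ => (1 : ℝ) := by
    funext x
    by_cases h1 : x ∈ A <;> simp [h1]
  rw [e1, e2, integral_indicator_const _ (hJ.measurableSet.inter hTA),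
    integral_indicator_const _ hA, integral_indicator_const _ hJ.measurableSet] at key
  simp only [smul_eq_mul, mul_one] at key
  refine key.trans ?_
  have h0 : 0 ≤ c * Real.exp (-τ * n) * μ.real A := by positivity
  calc _ ≤ c * Real.exp (-τ * n) * μ.real A * 3 :=
        mul_le_mul_of_nonneg_left (bvNorm_indicator_le_three hJ) h0
    _ = _ := by ring

/-! ### The mass of the ball with a given boundary point -/

/-- The measures of balls are bounded by a power of the radius. -/
def BallGrowth (μ : Measure (Set.Icc (0 : ℝ) 1)) (c s : ℝ) : Prop :=
  ∀ (x : Set.Icc (0 : ℝ) 1) (r : ℝ), 0 < r → μ.real (Metric.ball x r) ≤ c * r ^ s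

/-- The distribution function of `μ`, as a function on the whole line. -/
def massBelow (μ : Measure (Set.Icc (0 : ℝ) 1)) (u : ℝ) : ℝ :=
  μ.real {y | (y : ℝ) ≤ u}

/-- The measure of the open ball centred at `x` with the point `y` on its boundary. Up to ties, a
point `y` lies in a ball centred at `x` of measure `m` if and only if this is less than `m`. -/
def ballMass (μ : Measure (Set.Icc (0 : ℝ) 1)) (x y : Set.Icc (0 : ℝ) 1) : ℝ :=
  μ.real (Metric.ball x (dist x y))

section BallMass

variable {μ : Measure (Set.Icc (0 : ℝ) 1)} [IsProbabilityMeasure μ] {c s : ℝ}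

theorem massBelow_sub_eq {u v : ℝ} (huv : v ≤ u) :
    massBelow μ u - massBelow μ v = μ.real {y | v < (y : ℝ) ∧ (y : ℝ) ≤ u} := by
  have hm : MeasurableSet {y : Set.Icc (0 : ℝ) 1 | (y : ℝ) ≤ v} :=
    measurableSet_le measurable_subtype_coe measurable_const
  have hsub : {y : Set.Icc (0 : ℝ) 1 | (y : ℝ) ≤ v} ⊆ {y | (y : ℝ) ≤ u} :=
    fun y hy => le_trans hy huv
  rw [massBelow, massBelow, ← measureReal_sdiff hsub hm]
  congr 1
  ext y
  simp [and_comm]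

theorem BallGrowth.massBelow_sub_le (hc : 0 ≤ c) (h : BallGrowth μ c s) {u v : ℝ}
    (huv : v ≤ u) : massBelow μ u - massBelow μ v ≤ c * 2 ^ s * (u - v) ^ s := by
  rw [massBelow_sub_eq huv]
  have hnn : 0 ≤ c * 2 ^ s * (u - v) ^ s := by
    have := Real.rpow_nonneg (sub_nonneg.2 huv) s
    positivity
  rcases Set.eq_empty_or_nonempty {y : Set.Icc (0 : ℝ) 1 | v < (y : ℝ) ∧ (y : ℝ) ≤ u} with he | hne
  · rw [he]; simpa using hnn
  · obtain ⟨y₀, hy₀⟩ := hne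
    have hlt : 0 < u - v := by linarith [hy₀.1, hy₀.2]
    rw [mul_assoc, ← Real.mul_rpow (by norm_num) hlt.le]
    refine (measureReal_mono ?_).trans (h y₀ (2 * (u - v)) (by positivity))
    intro y hy
    rw [Metric.mem_ball, Subtype.dist_eq, Real.dist_eq, abs_lt]
    constructor <;> linarith [hy.1, hy.2, hy₀.1, hy₀.2]

theorem BallGrowth.abs_massBelow_sub_le (hc : 0 ≤ c) (h : BallGrowth μ c s)
    (u v : ℝ) : |massBelow μ u - massBelow μ v| ≤ c * 2 ^ s * |u - v| ^ s := by
  have hmono : Monotone (massBelow μ) := fun a b hab =>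
    measureReal_mono fun y (hy : (y : ℝ) ≤ a) => hy.trans hab
  rcases le_total v u with huv | huv
  · rw [abs_of_nonneg (sub_nonneg.2 (hmono huv)), abs_of_nonneg (sub_nonneg.2 huv)]
    exact h.massBelow_sub_le hc huv
  · rw [abs_sub_comm, abs_sub_comm u, abs_of_nonneg (sub_nonneg.2 (hmono huv)),
      abs_of_nonneg (sub_nonneg.2 huv)]
    exact h.massBelow_sub_le hc huv

theorem BallGrowth.continuous_massBelow (hc : 0 ≤ c) (hs : 0 < s) (h : BallGrowth μ c s) :
    Continuous (massBelow μ) := by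
  refine continuous_iff_continuousAt.2 fun v => ?_
  rw [ContinuousAt, tendsto_iff_dist_tendsto_zero]
  have hlim : Tendsto (fun u : ℝ => c * 2 ^ s * |u - v| ^ s) (𝓝 v) (𝓝 0) := by
    have hcont : Continuous fun u : ℝ => c * 2 ^ s * |u - v| ^ s :=
      continuous_const.mul ((continuous_id.sub continuous_const).abs.rpow_const
        fun _ => Or.inr hs.le)
    have := hcont.tendsto v
    simpa [Real.zero_rpow hs.ne'] using this
  exact squeeze_zero (fun _ => dist_nonneg) (fun u => h.abs_massBelow_sub_le hc u v) hlim

theorem BallGrowth.noAtoms (hc : 0 ≤ c) (hs : 0 < s) (h : BallGrowth μ c s) :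
    NullSingletonClass μ := by
  refine ⟨fun x => ?_⟩
  have hcont := h.continuous_massBelow hc hs
  have h1 : ∀ v < (x : ℝ), μ.real {x} ≤ massBelow μ x - massBelow μ v := fun v hv => by
    rw [massBelow_sub_eq hv.le]
    exact measureReal_mono (by rintro y rfl; exact ⟨hv, le_rfl⟩)
  have h2 : Tendsto (fun v => massBelow μ x - massBelow μ v) (𝓝[<] (x : ℝ)) (𝓝 0) := by
    have := (tendsto_const_nhds (x := massBelow μ x)).sub (hcont.tendsto (x : ℝ))
    rw [sub_self] at this
    exact this.mono_left nhdsWithin_le_nhds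
  have h3 : μ.real {x} ≤ 0 := ge_of_tendsto h2 (eventually_mem_nhdsWithin.mono fun v hv => h1 v hv)
  exact (measureReal_eq_zero_iff).1 (le_antisymm h3 measureReal_nonneg)

theorem ballMass_eq [NullSingletonClass μ] (x y : Set.Icc (0 : ℝ) 1) :
    ballMass μ x y = massBelow μ (x + dist x y) - massBelow μ (x - dist x y) := by
  have hd : 0 ≤ dist x y := dist_nonneg
  rw [massBelow_sub_eq (by linarith), ballMass]
  refine le_antisymm (measureReal_mono fun z hz => ?_) ?_
  · rw [Metric.mem_ball, Subtype.dist_eq, Real.dist_eq, abs_lt] at hz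
    exact ⟨by linarith, by linarith⟩
  · have hnull : μ.real {z : Set.Icc (0 : ℝ) 1 | (z : ℝ) = x + dist x y} = 0 := by
      refine (measureReal_eq_zero_iff).2 (Set.Subsingleton.measure_zero ?_ μ)
      intro a ha b hb
      exact Subtype.ext ((ha : (a : ℝ) = _).trans (hb : (b : ℝ) = _).symm)
    calc _ ≤ μ.real (Metric.ball x (dist x y) ∪ {z | (z : ℝ) = x + dist x y}) := by
          refine measureReal_mono fun z hz => ?_
          rcases hz.2.lt_or_eq with hlt | heq
          · left
            rw [Metric.mem_ball, Subtype.dist_eq, Real.dist_eq, abs_lt]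
            exact ⟨by linarith [hz.1], by linarith⟩
          · exact Or.inr heq
      _ ≤ _ := measureReal_union_le _ _
      _ = _ := by rw [hnull, add_zero]

theorem BallGrowth.continuous_ballMass (hc : 0 ≤ c) (hs : 0 < s) (h : BallGrowth μ c s) :
    Continuous fun p : Set.Icc (0 : ℝ) 1 × Set.Icc (0 : ℝ) 1 => ballMass μ p.1 p.2 := by
  have := h.noAtoms hc hs
  have hcont := h.continuous_massBelow hc hs
  simp only [ballMass_eq]
  fun_prop

/-- Moving the centre `x` moves both end points of the ball through `y` by at most twice as much. -/
theorem BallGrowth.abs_ballMass_sub_le (hc : 0 ≤ c) (hs : 0 < s) (h : BallGrowth μ c s)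
    {x x' : Set.Icc (0 : ℝ) 1} {δ : ℝ} (hx : |(x : ℝ) - x'| ≤ δ) (y : Set.Icc (0 : ℝ) 1) :
    |ballMass μ x y - ballMass μ x' y| ≤ 2 * (c * 4 ^ s) * δ ^ s := by
  have := h.noAtoms hc hs
  have hdd : |dist x y - dist x' y| ≤ δ := (abs_dist_sub_le x x' y).trans hx
  have hδ : 0 ≤ δ := (abs_nonneg _).trans hx
  have hb : ∀ u v : ℝ, |u - v| ≤ 2 * δ →
      |massBelow μ u - massBelow μ v| ≤ c * 4 ^ s * δ ^ s := fun u v huv => by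
    refine (h.abs_massBelow_sub_le hc u v).trans ?_
    have h4 : (4 : ℝ) ^ s = 2 ^ s * 2 ^ s := by
      rw [← Real.mul_rpow (by norm_num) (by norm_num)]; norm_num
    calc c * 2 ^ s * |u - v| ^ s ≤ c * 2 ^ s * (2 * δ) ^ s := by gcongr
      _ = _ := by rw [Real.mul_rpow (by norm_num) hδ, h4]; ring
  rw [abs_le] at hx hdd
  have h1 := abs_le.1 (hb (x + dist x y) (x' + dist x' y)
    (abs_le.2 ⟨by linarith [hx.1, hdd.1], by linarith [hx.2, hdd.2]⟩))
  have h2 := abs_le.1 (hb (x - dist x y) (x' - dist x' y)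
    (abs_le.2 ⟨by linarith [hx.1, hdd.2], by linarith [hx.2, hdd.1]⟩))
  rw [ballMass_eq, ballMass_eq, abs_le]
  constructor <;> linarith [h1.1, h1.2, h2.1, h2.2]

theorem ballMass_le_ballMass {x y z : Set.Icc (0 : ℝ) 1} (h : dist x y ≤ dist x z) :
    ballMass μ x y ≤ ballMass μ x z :=
  measureReal_mono (Metric.ball_subset_ball h)

theorem ordConnected_ballMass_le (x : Set.Icc (0 : ℝ) 1) (t : ℝ) :
    {y | ballMass μ x y ≤ t}.OrdConnected := by
  refine ⟨fun a ha b hb z hz => ?_⟩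
  rcases le_total z x with hzx | hzx
  · refine (ballMass_le_ballMass (z := a) ?_).trans ha
    have h1 : (a : ℝ) ≤ z := hz.1
    have h2 : (z : ℝ) ≤ x := hzx
    rw [Subtype.dist_eq, Subtype.dist_eq, Real.dist_eq, Real.dist_eq,
      abs_of_nonneg (by linarith), abs_of_nonneg (by linarith)]
    linarith
  · refine (ballMass_le_ballMass (z := b) ?_).trans hb
    have h1 : (z : ℝ) ≤ b := hz.2
    have h2 : (x : ℝ) ≤ z := hzx
    rw [Subtype.dist_eq, Subtype.dist_eq, Real.dist_eq, Real.dist_eq,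
      abs_of_nonpos (by linarith), abs_of_nonpos (by linarith)]
    linarith

/-- One half of the probability integral transform for `ballMass μ x`: the sublevel set lies in
the closed ball through its point farthest from `x`. -/
theorem BallGrowth.measure_ballMass_le (hc : 0 ≤ c) (hs : 0 < s) (h : BallGrowth μ c s)
    (x : Set.Icc (0 : ℝ) 1) {t : ℝ} (ht : 0 ≤ t) : μ.real {y | ballMass μ x y ≤ t} ≤ t := by
  have := h.noAtoms hc hs
  have hcont : Continuous fun y => ballMass μ x y :=
    (h.continuous_ballMass hc hs).comp (continuous_const.prodMk continuous_id)
  rcases Set.eq_empty_or_nonempty {y | ballMass μ x y ≤ t} with he | hne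
  · rw [he]; simpa using ht
  · have hK : IsCompact {y | ballMass μ x y ≤ t} :=
      (isClosed_le hcont continuous_const).isCompact
    obtain ⟨z, hz, hmax⟩ := hK.exists_isMaxOn hne
      (continuous_const.dist continuous_id : Continuous fun y => dist x y).continuousOn
    have hsphere : μ.real {y | dist x y = dist x z} = 0 := by
      refine (measureReal_eq_zero_iff).2 (Set.Finite.measure_zero ?_ μ)
      refine Set.Finite.of_finite_image (f := fun y : Set.Icc (0 : ℝ) 1 => (y : ℝ))
        ((Set.finite_singleton ((x : ℝ) + dist x z)).insert ((x : ℝ) - dist x z) |>.subset ?_)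
        Subtype.val_injective.injOn
      rintro _ ⟨y, hy, rfl⟩
      have hy' : |(x : ℝ) - y| = dist x z := by rw [← hy]; rfl
      rcases abs_choice ((x : ℝ) - y) with h' | h' <;> rw [h'] at hy'
      · left; linarith
      · right; simp only [Set.mem_singleton_iff]; linarith
    calc _ ≤ μ.real (Metric.ball x (dist x z) ∪ {y | dist x y = dist x z}) := by
          refine measureReal_mono fun y hy => ?_
          have hle : dist x y ≤ dist x z := hmax hy
          rcases hle.lt_or_eq with hlt | heq
          · left; rwa [Metric.mem_ball, dist_comm]
          · exact Or.inr heq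
      _ ≤ _ := measureReal_union_le _ _
      _ = ballMass μ x z := by rw [hsphere, add_zero]; rfl
      _ ≤ t := hz

/-- The other half of the probability integral transform: the sublevel set contains the open ball
through the point closest to `x` of its complement. -/
theorem BallGrowth.le_measure_ballMass_lt (hc : 0 ≤ c) (hs : 0 < s) (h : BallGrowth μ c s)
    (x : Set.Icc (0 : ℝ) 1) {t : ℝ} (ht : t ≤ 1) : t ≤ μ.real {y | ballMass μ x y < t} := by
  have hcont : Continuous fun y => ballMass μ x y :=
    (h.continuous_ballMass hc hs).comp (continuous_const.prodMk continuous_id)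
  rcases Set.eq_empty_or_nonempty {y | t ≤ ballMass μ x y} with he | hne
  · have : {y | ballMass μ x y < t} = Set.univ := by
      refine Set.eq_univ_of_forall fun y => ?_
      by_contra hy
      have hy' : y ∈ {y | t ≤ ballMass μ x y} := by simpa using hy
      rw [he] at hy'
      exact hy'
    rw [this]; simpa using ht
  · have hK : IsCompact {y | t ≤ ballMass μ x y} :=
      (isClosed_le continuous_const hcont).isCompact
    obtain ⟨z, hz, hmin⟩ := hK.exists_isMinOn hne
      (continuous_const.dist continuous_id : Continuous fun y => dist x y).continuousOn
    refine (hz : t ≤ ballMass μ x z).trans (measureReal_mono fun y hy => ?_)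
    by_contra hy'
    have hy'' : y ∈ {y | t ≤ ballMass μ x y} := by simpa using hy'
    have : dist x z ≤ dist x y := hmin hy''
    rw [Metric.mem_ball, dist_comm] at hy
    linarith

end BallMass

/-! ### Measure and correlations of the recurrence events -/

/-- The `i`-th cell of the partition of `[0,1]` into intervals of length `1 / N`. The last cell,
with index `N`, consists of the point `1` only. -/
def cell (N i : ℕ) : Set (Set.Icc (0 : ℝ) 1) := {x | ⌊(N : ℝ) * x⌋₊ = i}

/-- The left end point of the `i`-th cell, for `i ≤ N` (and the point `1` for larger `i`). -/
def cellPoint (N i : ℕ) : Set.Icc (0 : ℝ) 1 :=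
  ⟨min ((i : ℝ) / N) 1, by positivity, min_le_right _ _⟩

theorem ordConnected_cell (N i : ℕ) : (cell N i).OrdConnected := by
  refine ⟨fun a ha b hb z hz => ?_⟩
  have hmono : ∀ {u v : Set.Icc (0 : ℝ) 1}, u ≤ v → ⌊(N : ℝ) * u⌋₊ ≤ ⌊(N : ℝ) * v⌋₊ :=
    fun {u v} huv => Nat.floor_le_floor
      (mul_le_mul_of_nonneg_left (Subtype.coe_le_coe.2 huv) (Nat.cast_nonneg N))
  have h1 : ⌊(N : ℝ) * a⌋₊ = i := ha
  have h2 : ⌊(N : ℝ) * b⌋₊ = i := hb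
  exact le_antisymm ((hmono hz.2).trans h2.le) (h1.ge.trans (hmono hz.1))

theorem abs_sub_cellPoint_le {N i : ℕ} (hN : 0 < N) {x : Set.Icc (0 : ℝ) 1} (hx : x ∈ cell N i) :
    |(x : ℝ) - cellPoint N i| ≤ 1 / N := by
  have hN' : (0 : ℝ) < N := Nat.cast_pos.2 hN
  have hfl : ⌊(N : ℝ) * x⌋₊ = i := hx
  have h1 : (i : ℝ) ≤ N * x := hfl ▸ Nat.floor_le (mul_nonneg hN'.le x.2.1)
  have h2 : (N : ℝ) * x < i + 1 := hfl ▸ Nat.lt_floor_add_one _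
  have h3 : (i : ℝ) / N ≤ x := by rw [div_le_iff₀ hN']; linarith
  have h4 : (x : ℝ) ≤ i / N + 1 / N := by
    rw [← add_div, le_div_iff₀ hN']; linarith
  have h5 : ((cellPoint N i : Set.Icc (0 : ℝ) 1) : ℝ) = i / N := min_eq_left (h3.trans x.2.2)
  rw [h5, abs_le]
  constructor <;> linarith [one_div_pos.2 hN']

section Mixing

variable {T : Set.Icc (0 : ℝ) 1 → Set.Icc (0 : ℝ) 1} {μ : Measure (Set.Icc (0 : ℝ) 1)}
  [IsProbabilityMeasure μ] {c τ : ℝ}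

theorem sum_measureReal_cell_inter (N : ℕ) {S : Set (Set.Icc (0 : ℝ) 1)} (hS : MeasurableSet S) :
    ∑ i ∈ Finset.range (N + 1), μ.real (cell N i ∩ S) = μ.real S := by
  rw [← measureReal_biUnion_finset]
  · congr 1
    ext x
    simp only [Set.mem_iUnion, Set.mem_inter_iff, exists_prop, Finset.mem_range]
    refine ⟨fun ⟨_, _, _, h⟩ => h, fun h => ⟨⌊(N : ℝ) * x⌋₊, ?_, rfl, h⟩⟩
    refine Nat.lt_succ_of_le (Nat.floor_le_of_le ?_)
    exact mul_le_of_le_one_right (Nat.cast_nonneg N) x.2.2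
  · intro i _ j _ hij
    refine Set.disjoint_left.2 fun x hx hx' => hij ?_
    have h1 : ⌊(N : ℝ) * x⌋₊ = i := hx.1
    have h2 : ⌊(N : ℝ) * x⌋₊ = j := hx'.1
    exact h1.symm.trans h2
  · exact fun i _ => (ordConnected_cell N i).measurableSet.inter hS

theorem sum_measureReal_cell (N : ℕ) :
    ∑ i ∈ Finset.range (N + 1), μ.real (cell N i) = 1 := by
  simpa using sum_measureReal_cell_inter (μ := μ) N MeasurableSet.univ

/-- If a target of measure at most `v` is attached to each cell, the points hitting the target of
their own cell at time `k` have measure at most about `v`. -/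
theorem ExpMixingSets.sum_cell_inter_preimage_le (h : ExpMixingSets T μ c τ) (hc : 0 ≤ c)
    (N k : ℕ) {A : ℕ → Set (Set.Icc (0 : ℝ) 1)} (hA : ∀ i, MeasurableSet (A i)) {v : ℝ}
    (hv : ∀ i, μ.real (A i) ≤ v) :
    ∑ i ∈ Finset.range (N + 1), μ.real (cell N i ∩ T^[k] ⁻¹' A i)
      ≤ v * (1 + c * Real.exp (-τ * k) * (N + 1)) := by
  have hterm : ∀ i ∈ Finset.range (N + 1), μ.real (cell N i ∩ T^[k] ⁻¹' A i)
      ≤ v * μ.real (cell N i) + v * (c * Real.exp (-τ * k)) := fun i _ => by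
    have h1 := (abs_le.1 (h (A i) (cell N i) (hA i) (ordConnected_cell N i) k)).2
    have h2 : μ.real (A i) * μ.real (cell N i) ≤ v * μ.real (cell N i) :=
      mul_le_mul_of_nonneg_right (hv i) measureReal_nonneg
    have h3 : c * Real.exp (-τ * k) * μ.real (A i) ≤ c * Real.exp (-τ * k) * v :=
      mul_le_mul_of_nonneg_left (hv i) (by positivity)
    linarith
  refine (Finset.sum_le_sum hterm).trans (le_of_eq ?_)
  rw [Finset.sum_add_distrib, ← Finset.mul_sum, sum_measureReal_cell]
  simp
  ring

theorem ExpMixingSets.le_sum_cell_inter_preimage (h : ExpMixingSets T μ c τ) (hc : 0 ≤ c)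
    (N k : ℕ) {A : ℕ → Set (Set.Icc (0 : ℝ) 1)} (hA : ∀ i, MeasurableSet (A i)) {v : ℝ}
    (hv : ∀ i, v ≤ μ.real (A i)) :
    v - c * Real.exp (-τ * k) * (N + 1)
      ≤ ∑ i ∈ Finset.range (N + 1), μ.real (cell N i ∩ T^[k] ⁻¹' A i) := by
  have hterm : ∀ i ∈ Finset.range (N + 1), v * μ.real (cell N i) - c * Real.exp (-τ * k)
      ≤ μ.real (cell N i ∩ T^[k] ⁻¹' A i) := fun i _ => by
    have h1 := (abs_le.1 (h (A i) (cell N i) (hA i) (ordConnected_cell N i) k)).1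
    have h2 : v * μ.real (cell N i) ≤ μ.real (A i) * μ.real (cell N i) :=
      mul_le_mul_of_nonneg_right (hv i) measureReal_nonneg
    have h3 : c * Real.exp (-τ * k) * μ.real (A i) ≤ c * Real.exp (-τ * k) :=
      mul_le_of_le_one_right (by positivity) measureReal_le_one
    linarith
  refine (le_of_eq ?_).trans (Finset.sum_le_sum hterm)
  rw [Finset.sum_sub_distrib, ← Finset.mul_sum, sum_measureReal_cell]
  simp
  ring

/-- `E k` is the event that `T^k x` lies in the ball of measure `m k` around `x`; whether the
points on the boundary of that ball are counted is left open. -/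
structure IsRecurrenceEvents (T : Set.Icc (0 : ℝ) 1 → Set.Icc (0 : ℝ) 1)
    (μ : Measure (Set.Icc (0 : ℝ) 1)) (m : ℕ → ℝ) (E : ℕ → Set (Set.Icc (0 : ℝ) 1)) : Prop where
  measurableSet : ∀ k, MeasurableSet (E k)
  mem_of_lt : ∀ k x, ballMass μ x (T^[k] x) < m k → x ∈ E k
  le_of_mem : ∀ k, ∀ x ∈ E k, ballMass μ x (T^[k] x) ≤ m k

variable {b s : ℝ} {m : ℕ → ℝ} {E : ℕ → Set (Set.Icc (0 : ℝ) 1)}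

theorem IsRecurrenceEvents.cell_inter_subset (hE : IsRecurrenceEvents T μ m E)
    (hb : 0 ≤ b) (hs : 0 < s) (hg : BallGrowth μ b s) {N : ℕ} (hN : 0 < N) (i k : ℕ) :
    cell N i ∩ E k ⊆ cell N i ∩ T^[k] ⁻¹'
      {y | ballMass μ (cellPoint N i) y ≤ m k + 2 * (b * 4 ^ s) * (1 / N) ^ s} := by
  rintro x ⟨hx, hxE⟩
  refine ⟨hx, ?_⟩
  have h1 := abs_le.1 (hg.abs_ballMass_sub_le hb hs (abs_sub_cellPoint_le hN hx) (T^[k] x))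
  have h2 := hE.le_of_mem k x hxE
  change ballMass μ (cellPoint N i) (T^[k] x) ≤ _
  linarith [h1.1]

theorem IsRecurrenceEvents.subset_cell_inter (hE : IsRecurrenceEvents T μ m E)
    (hb : 0 ≤ b) (hs : 0 < s) (hg : BallGrowth μ b s) {N : ℕ} (hN : 0 < N) (i k : ℕ) :
    cell N i ∩ T^[k] ⁻¹'
      {y | ballMass μ (cellPoint N i) y < m k - 2 * (b * 4 ^ s) * (1 / N) ^ s}
      ⊆ cell N i ∩ E k := by
  rintro x ⟨hx, hxE⟩
  refine ⟨hx, hE.mem_of_lt k x ?_⟩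
  have h1 := abs_le.1 (hg.abs_ballMass_sub_le hb hs (abs_sub_cellPoint_le hN hx) (T^[k] x))
  have h2 : ballMass μ (cellPoint N i) (T^[k] x) < _ := hxE
  linarith [h1.2]

theorem BallGrowth.measurable_ballMass (hb : 0 ≤ b) (hs : 0 < s) (hg : BallGrowth μ b s)
    (x : Set.Icc (0 : ℝ) 1) : Measurable fun y => ballMass μ x y :=
  ((hg.continuous_ballMass hb hs).comp (continuous_const.prodMk continuous_id)).measurable

theorem IsRecurrenceEvents.measureReal_le (hE : IsRecurrenceEvents T μ m E)
    (hm : ∀ k, 0 ≤ m k) (hb : 0 ≤ b) (hs : 0 < s) (hg : BallGrowth μ b s)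
    (h : ExpMixingSets T μ c τ) (hc : 0 ≤ c) {N : ℕ} (hN : 0 < N) (k : ℕ) :
    μ.real (E k) ≤ (m k + 2 * (b * 4 ^ s) * (1 / N) ^ s)
      * (1 + c * Real.exp (-τ * k) * (N + 1)) := by
  rw [← sum_measureReal_cell_inter N (hE.measurableSet k)]
  refine (Finset.sum_le_sum fun i _ =>
    measureReal_mono (hE.cell_inter_subset hb hs hg hN i k)).trans ?_
  refine h.sum_cell_inter_preimage_le hc N k
    (fun i => measurableSet_le (hg.measurable_ballMass hb hs _) measurable_const) fun i => ?_
  exact hg.measure_ballMass_le hb hs _ (add_nonneg (hm k) (by positivity))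

theorem IsRecurrenceEvents.le_measureReal (hE : IsRecurrenceEvents T μ m E)
    (hm : ∀ k, m k ≤ 1) (hb : 0 ≤ b) (hs : 0 < s) (hg : BallGrowth μ b s)
    (h : ExpMixingSets T μ c τ) (hc : 0 ≤ c) {N : ℕ} (hN : 0 < N) (k : ℕ) :
    m k - 2 * (b * 4 ^ s) * (1 / N) ^ s - c * Real.exp (-τ * k) * (N + 1) ≤ μ.real (E k) := by
  rw [← sum_measureReal_cell_inter N (hE.measurableSet k)]
  refine le_trans ?_ (Finset.sum_le_sum fun i _ =>
    measureReal_mono (hE.subset_cell_inter hb hs hg hN i k))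
  refine h.le_sum_cell_inter_preimage hc N k
    (fun i => measurableSet_lt (hg.measurable_ballMass hb hs _) measurable_const) fun i => ?_
  refine hg.le_measure_ballMass_lt hb hs _ ?_
  have : 0 ≤ 2 * (b * 4 ^ s) * (1 / (N : ℝ)) ^ s := by positivity
  linarith [hm k]

/-- On each cell both events are replaced by fixed targets, intervals of measure about `m k` and
`m (k + j)`. Mixing over the time `j` decorrelates the two targets, and mixing over the time `k`
decorrelates their combination from the cell. -/
theorem IsRecurrenceEvents.measureReal_inter_le (hE : IsRecurrenceEvents T μ m E)
    (hT : Measurable T)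
    (hm : ∀ k, 0 ≤ m k) (hb : 0 ≤ b) (hs : 0 < s) (hg : BallGrowth μ b s)
    (h : ExpMixingSets T μ c τ) (hc : 0 ≤ c) {N : ℕ} (hN : 0 < N) (k j : ℕ) :
    μ.real (E k ∩ E (k + j)) ≤
      (m (k + j) + 2 * (b * 4 ^ s) * (1 / N) ^ s) *
      (m k + 2 * (b * 4 ^ s) * (1 / N) ^ s + c * Real.exp (-τ * j))
      * (1 + c * Real.exp (-τ * k) * (N + 1)) := by
  set η : ℝ := 2 * (b * 4 ^ s) * (1 / N) ^ s with hη
  have hη0 : 0 ≤ η := by positivity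
  set A : ℕ → ℕ → Set (Set.Icc (0 : ℝ) 1) :=
    fun l i => {y | ballMass μ (cellPoint N i) y ≤ m l + η} with hAdef
  have hA : ∀ l i, MeasurableSet (A l i) := fun l i =>
    measurableSet_le (hg.measurable_ballMass hb hs _) measurable_const
  have hAμ : ∀ l i, μ.real (A l i) ≤ m l + η := fun l i =>
    hg.measure_ballMass_le hb hs _ (add_nonneg (hm l) hη0)
  rw [← sum_measureReal_cell_inter N ((hE.measurableSet k).inter (hE.measurableSet (k + j)))]
  have hsub : ∀ i, cell N i ∩ (E k ∩ E (k + j)) ⊆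
      cell N i ∩ T^[k] ⁻¹' (A k i ∩ T^[j] ⁻¹' A (k + j) i) := by
    rintro i x ⟨hx, hxk, hxl⟩
    refine ⟨hx, (hE.cell_inter_subset hb hs hg hN i k ⟨hx, hxk⟩).2, ?_⟩
    have h2 := (hE.cell_inter_subset hb hs hg hN i (k + j) ⟨hx, hxl⟩).2
    rw [Set.mem_preimage, add_comm k j, Function.iterate_add_apply] at h2
    rw [add_comm k j]
    exact h2
  refine (Finset.sum_le_sum fun i _ => measureReal_mono (hsub i)).trans ?_
  refine h.sum_cell_inter_preimage_le hc N k
    (fun i => (hA k i).inter (hT.iterate j (hA (k + j) i))) fun i => ?_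
  have h1 := (abs_le.1 (h (A (k + j) i) (A k i) (hA _ i) (ordConnected_ballMass_le _ _) j)).2
  have h2 : μ.real (A (k + j) i) * (μ.real (A k i) + c * Real.exp (-τ * j)) ≤
      (m (k + j) + η) * (m k + η + c * Real.exp (-τ * j)) := by
    have := hAμ (k + j) i
    have := hAμ k i
    have := hm (k + j)
    gcongr
  linarith

end Mixing

section Rates

variable {T : Set.Icc (0 : ℝ) 1 → Set.Icc (0 : ℝ) 1} {μ : Measure (Set.Icc (0 : ℝ) 1)}
  [IsProbabilityMeasure μ] {c τ b s : ℝ}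

/-- The number of cells that balances, up to exponentially small errors, the variation of the
balls over a cell against the total mixing error over all cells. -/
theorem exists_cell_number (hc : 0 < c) (hτ : 0 < τ) (hb : 0 < b) (hs : 0 < s) :
    ∃ C γ : ℝ, 0 < C ∧ 0 < γ ∧ γ ≤ τ ∧ ∀ k : ℕ, ∃ N : ℕ, 0 < N ∧
      2 * (b * 4 ^ s) * (1 / N) ^ s ≤ C * Real.exp (-γ * k) ∧
      c * Real.exp (-τ * k) * (N + 1) ≤ C * Real.exp (-γ * k) := by
  refine ⟨2 * (b * 4 ^ s) + 3 * c, min (τ / 2) (s * τ / 2), by positivity, by positivity,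
    (min_le_left _ _).trans (by linarith), fun k => ⟨⌈Real.exp (τ / 2 * k)⌉₊, ?_, ?_, ?_⟩⟩
  · exact Nat.ceil_pos.2 (Real.exp_pos _)
  · have hN : Real.exp (τ / 2 * k) ≤ ⌈Real.exp (τ / 2 * k)⌉₊ := Nat.le_ceil _
    have h1 : (1 / (⌈Real.exp (τ / 2 * k)⌉₊ : ℝ)) ^ s ≤ Real.exp (-(s * τ / 2) * k) := by
      calc _ ≤ (1 / Real.exp (τ / 2 * k)) ^ s := by
            have := Real.exp_pos (τ / 2 * k)
            gcongr
        _ = _ := by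
            rw [one_div, ← Real.exp_neg, ← Real.exp_mul]
            congr 1; ring
    have h2 : Real.exp (-(s * τ / 2) * k) ≤ Real.exp (-min (τ / 2) (s * τ / 2) * k) := by
      have := min_le_right (τ / 2) (s * τ / 2)
      gcongr
    calc _ ≤ 2 * (b * 4 ^ s) * Real.exp (-min (τ / 2) (s * τ / 2) * k) :=
          mul_le_mul_of_nonneg_left (h1.trans h2) (by positivity)
      _ ≤ _ := by
          gcongr
          linarith
  · have hN : (⌈Real.exp (τ / 2 * k)⌉₊ : ℝ) < Real.exp (τ / 2 * k) + 1 :=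
      Nat.ceil_lt_add_one (Real.exp_pos _).le
    have h1 : (1 : ℝ) ≤ Real.exp (τ / 2 * k) := Real.one_le_exp (by positivity)
    have h2 : Real.exp (-(τ / 2) * k) ≤ Real.exp (-min (τ / 2) (s * τ / 2) * k) := by
      have := min_le_left (τ / 2) (s * τ / 2)
      gcongr
    calc c * Real.exp (-τ * k) * (⌈Real.exp (τ / 2 * k)⌉₊ + 1)
        ≤ c * Real.exp (-τ * k) * (3 * Real.exp (τ / 2 * k)) := by
          gcongr
          linarith
      _ = 3 * c * Real.exp (-(τ / 2) * k) := by
          have : Real.exp (-(τ / 2) * k) = Real.exp (-τ * k) * Real.exp (τ / 2 * k) := by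
            rw [← Real.exp_add]; congr 1; ring
          rw [this]; ring
      _ ≤ 3 * c * Real.exp (-min (τ / 2) (s * τ / 2) * k) := by gcongr
      _ ≤ _ := by
          gcongr
          linarith [show 0 ≤ 2 * (b * 4 ^ s) by positivity]

/-- Events `E k` with measure `m k` up to an exponentially small error whose correlations decay
exponentially, except for an error depending on the smaller of the two indices. -/
structure IsQuasiIndependent (μ : Measure (Set.Icc (0 : ℝ) 1)) (m : ℕ → ℝ)
    (E : ℕ → Set (Set.Icc (0 : ℝ) 1)) (C γ : ℝ) : Prop where
  measurableSet : ∀ k, MeasurableSet (E k)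
  measureReal_le : ∀ k : ℕ, μ.real (E k) ≤ m k + C * Real.exp (-γ * k)
  le_measureReal : ∀ k : ℕ, m k - C * Real.exp (-γ * k) ≤ μ.real (E k)
  measureReal_inter_le : ∀ k j : ℕ, μ.real (E k ∩ E (k + j)) ≤
    m k * m (k + j) + C * Real.exp (-γ * k) + C * m (k + j) * Real.exp (-γ * j)

theorem exists_isQuasiIndependent (hT : Measurable T) (hc : 0 < c) (hτ : 0 < τ)
    (h : ExpMixingSets T μ c τ) (hb : 0 < b) (hs : 0 < s) (hg : BallGrowth μ b s) :
    ∃ C γ : ℝ, 0 < C ∧ 0 < γ ∧ ∀ (m : ℕ → ℝ) (E : ℕ → Set (Set.Icc (0 : ℝ) 1)),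
      (∀ k, 0 ≤ m k) → (∀ k, m k ≤ 1) → IsRecurrenceEvents T μ m E →
      IsQuasiIndependent μ m E C γ := by
  obtain ⟨K, γ, hK, hγ, hγτ, hcell⟩ := exists_cell_number hc hτ hb hs
  -- The constant of the error terms that remain when the product in
  -- `IsRecurrenceEvents.measureReal_inter_le` is expanded.
  refine ⟨K * (1 + (2 + K + c) * (1 + K)) + c * (1 + K), γ, by positivity, hγ,
    fun m E hm0 hm1 hE => ⟨hE.measurableSet, fun k => ?_, fun k => ?_, fun k j => ?_⟩⟩
  all_goals obtain ⟨N, hN, h1, h2⟩ := hcell k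
  all_goals
    set θ : ℝ := K * Real.exp (-γ * k) with hθ
    have hθ0 : 0 ≤ θ := by positivity
    have he1 : Real.exp (-γ * k) ≤ 1 := Real.exp_le_one_iff.2 (by
      have : 0 ≤ γ * k := by positivity
      linarith)
    have hθK : θ ≤ K := mul_le_of_le_one_right hK.le he1
    have hk0 := hm0 k
    have hk1 := hm1 k
    have he0 := Real.exp_pos (-γ * k)
  · have hC : K * (2 + K) ≤ K * (1 + (2 + K + c) * (1 + K)) + c * (1 + K) := by
      nlinarith [mul_pos hK hK, mul_pos hK hc, mul_pos (mul_pos hK hK) hc,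
        mul_pos (mul_pos hK hK) hK]
    calc μ.real (E k) ≤ _ := hE.measureReal_le hm0 hb.le hs hg h hc.le hN k
      _ ≤ (m k + θ) * (1 + θ) := by gcongr
      _ = m k + θ * (1 + m k + θ) := by ring
      _ ≤ m k + θ * (2 + K) := by gcongr; linarith
      _ = m k + K * (2 + K) * Real.exp (-γ * k) := by rw [hθ]; ring
      _ ≤ _ := by gcongr
  · have hC : 2 * K ≤ K * (1 + (2 + K + c) * (1 + K)) + c * (1 + K) := by
      nlinarith [mul_pos hK hK, mul_pos hK hc, mul_pos (mul_pos hK hK) hc,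
        mul_pos (mul_pos hK hK) hK]
    have := hE.le_measureReal hm1 hb.le hs hg h hc.le hN k
    have := mul_le_mul_of_nonneg_right hC he0.le
    linarith
  · set ρ : ℝ := c * Real.exp (-τ * j) with hρ
    have hρ0 : 0 ≤ ρ := by positivity
    have hj : Real.exp (-τ * j) ≤ Real.exp (-γ * j) := by gcongr
    have hj1 : Real.exp (-γ * j) ≤ 1 := Real.exp_le_one_iff.2 (by
      have : 0 ≤ γ * j := by positivity
      linarith)
    have hρ1 : ρ ≤ c := mul_le_of_le_one_right hc.le (hj.trans hj1)
    have hl0 := hm0 (k + j)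
    have hl1 := hm1 (k + j)
    have hprod : m (k + j) * m k ≤ 1 := mul_le_one₀ hl1 hk0 hk1
    calc μ.real (E k ∩ E (k + j)) ≤ _ :=
          hE.measureReal_inter_le hT hm0 hb.le hs hg h hc.le hN k j
      _ ≤ (m (k + j) + θ) * (m k + θ + ρ) * (1 + θ) := by gcongr
      _ = m k * m (k + j) + θ * (m (k + j) * m k + (m (k + j) + m k + θ + ρ) * (1 + θ))
            + ρ * m (k + j) * (1 + θ) := by ring
      _ ≤ m k * m (k + j) + θ * (1 + (2 + K + c) * (1 + K))
            + c * Real.exp (-γ * j) * m (k + j) * (1 + K) := by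
          have : m (k + j) + m k + θ + ρ ≤ 2 + K + c := by linarith
          have : ρ ≤ c * Real.exp (-γ * j) := mul_le_mul_of_nonneg_left hj hc.le
          gcongr
      _ = m k * m (k + j) + K * (1 + (2 + K + c) * (1 + K)) * Real.exp (-γ * k)
            + c * (1 + K) * m (k + j) * Real.exp (-γ * j) := by rw [hθ]; ring
      _ ≤ _ := by
          gcongr
          · exact le_add_of_nonneg_right (by positivity)
          · exact le_add_of_nonneg_left (by positivity)
end Rates

/-! ### The second moment of the counting function -/

theorem exists_sum_exp_abs_sub_le {γ : ℝ} (hγ : 0 < γ) :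
    ∃ G : ℝ, 0 < G ∧ ∀ (k : ℕ) (F : Finset ℕ),
      ∑ l ∈ F, Real.exp (-γ * |(k : ℝ) - l|) ≤ G := by
  have hgeom : Summable fun n : ℕ => Real.exp (-γ * |((n : ℤ) : ℝ)|) := by
    have : Summable fun n : ℕ => Real.exp (-γ) ^ n :=
      summable_geometric_of_lt_one (Real.exp_pos _).le (Real.exp_lt_one_iff.2 (by linarith))
    refine this.congr fun n => ?_
    rw [← Real.exp_nat_mul, Int.cast_natCast, Nat.abs_cast]
    congr 1; ring
  have hsum : Summable fun i : ℤ => Real.exp (-γ * |(i : ℝ)|) :=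
    Summable.of_nat_of_neg hgeom (by simpa using hgeom)
  refine ⟨∑' i : ℤ, Real.exp (-γ * |(i : ℝ)|), hsum.tsum_pos (fun i => (Real.exp_pos _).le) 0
    (Real.exp_pos _), fun k F => ?_⟩
  have hinj : Function.Injective fun l : ℕ => (k : ℤ) - l := fun a b hab => by
    simpa using hab
  have h1 : ∑ l ∈ F, Real.exp (-γ * |(k : ℝ) - l|)
      = ∑ i ∈ F.map ⟨_, hinj⟩, Real.exp (-γ * |(i : ℝ)|) := by
    rw [Finset.sum_map]
    simp
  rw [h1]
  exact hsum.sum_le_tsum _ fun i _ => (Real.exp_pos _).le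

section SecondMoment

variable {μ : Measure (Set.Icc (0 : ℝ) 1)} [IsProbabilityMeasure μ] {m : ℕ → ℝ}
  {E : ℕ → Set (Set.Icc (0 : ℝ) 1)} {C γ : ℝ}

theorem integrable_centered_indicator_mul {A B : Set (Set.Icc (0 : ℝ) 1)} (hA : MeasurableSet A)
    (hB : MeasurableSet B) (a b : ℝ) :
    Integrable (fun x => (A.indicator (fun _ => (1 : ℝ)) x - a)
      * (B.indicator (fun _ => (1 : ℝ)) x - b)) μ := by
  have h1 : Integrable (fun x => A.indicator (fun _ => (1 : ℝ)) x - a) μ :=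
    ((integrable_const 1).indicator hA).sub (integrable_const a)
  refine h1.mul_bdd (c := 1 + |b|) ?_ (ae_of_all _ fun x => ?_)
  · exact (((integrable_const 1).indicator hB).sub (integrable_const b)).aestronglyMeasurable
  · refine (norm_sub_le _ _).trans (add_le_add ?_ le_rfl)
    by_cases hx : x ∈ B <;> simp [hx]

theorem integral_centered_indicator_mul {A B : Set (Set.Icc (0 : ℝ) 1)} (hA : MeasurableSet A)
    (hB : MeasurableSet B) (a b : ℝ) :
    ∫ x, (A.indicator (fun _ => (1 : ℝ)) x - a) * (B.indicator (fun _ => (1 : ℝ)) x - b) ∂μ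
      = μ.real (A ∩ B) - a * μ.real B - b * μ.real A + a * b := by
  have h1 : (fun x => (A.indicator (fun _ => (1 : ℝ)) x - a)
      * (B.indicator (fun _ => (1 : ℝ)) x - b))
      = fun x => (A ∩ B).indicator (fun _ => (1 : ℝ)) x - a * B.indicator (fun _ => (1 : ℝ)) x
        - b * A.indicator (fun _ => (1 : ℝ)) x + a * b := by
    funext x
    by_cases hx : x ∈ A <;> by_cases hx' : x ∈ B <;> simp [hx, hx'] <;> ring
  have iA : Integrable (A.indicator fun _ => (1 : ℝ)) μ := (integrable_const 1).indicator hA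
  have iB : Integrable (B.indicator fun _ => (1 : ℝ)) μ := (integrable_const 1).indicator hB
  have iAB : Integrable ((A ∩ B).indicator fun _ => (1 : ℝ)) μ :=
    (integrable_const 1).indicator (hA.inter hB)
  have i1 : Integrable (fun x => (A ∩ B).indicator (fun _ => (1 : ℝ)) x
      - a * B.indicator (fun _ => (1 : ℝ)) x) μ := iAB.sub (iB.const_mul a)
  have i2 : Integrable (fun x => (A ∩ B).indicator (fun _ => (1 : ℝ)) x
      - a * B.indicator (fun _ => (1 : ℝ)) x - b * A.indicator (fun _ => (1 : ℝ)) x) μ :=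
    i1.sub (iA.const_mul b)
  rw [h1, integral_add i2 (integrable_const _),
    integral_sub i1 (iA.const_mul b), integral_sub iAB (iB.const_mul a),
    integral_const_mul, integral_const_mul, integral_indicator_const _ (hA.inter hB),
    integral_indicator_const _ hA, integral_indicator_const _ hB]
  simp

theorem IsQuasiIndependent.covariance_le (h : IsQuasiIndependent μ m E C γ) (hC : 0 < C)
    (hm0 : ∀ k, 0 ≤ m k) (hm1 : ∀ k, m k ≤ 1) {t : ℝ} {k l : ℕ}
    (hk : Real.exp (-γ * k) ≤ t) (hl : Real.exp (-γ * l) ≤ t) :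
    ∫ x, ((E k).indicator (fun _ => (1 : ℝ)) x - m k)
        * ((E l).indicator (fun _ => (1 : ℝ)) x - m l) ∂μ
      ≤ (3 * C + 1) * (t + (m k + m l) * Real.exp (-γ * |(k : ℝ) - l|)) := by
  have ht : 0 < t := (Real.exp_pos _).trans_le hk
  -- The bound is symmetric in `k` and `l`.
  wlog hkl : k ≤ l generalizing k l
  · have := this hl hk (le_of_not_ge hkl)
    rw [abs_sub_comm, add_comm (m k)]
    simpa only [mul_comm] using this
  rw [integral_centered_indicator_mul (h.measurableSet k) (h.measurableSet l)]
  have hmk := hm0 k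
  have hml := hm0 l
  have hmk1 := hm1 k
  have hml1 := hm1 l
  rcases hkl.eq_or_lt with rfl | hlt
  · have h1 := h.measureReal_le k
    have h2 : C * Real.exp (-γ * k) ≤ C * t := by gcongr
    have h3 : 0 ≤ m k * μ.real (E k) := by positivity
    have h4 : m k * m k ≤ m k := mul_le_of_le_one_left hmk hmk1
    rw [Set.inter_self, sub_self, abs_zero, mul_zero, Real.exp_zero]
    nlinarith [mul_pos hC ht, mul_nonneg hC.le hmk]
  · obtain ⟨j, rfl⟩ := Nat.exists_eq_add_of_le hkl
    have habs : |(k : ℝ) - ((k + j : ℕ) : ℝ)| = j := by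
      rw [abs_sub_comm]; push_cast; simp
    rw [habs]
    have h1 := h.measureReal_inter_le k j
    have h2 : m k * (m (k + j) - C * t) ≤ m k * μ.real (E (k + j)) := by
      have := h.le_measureReal (k + j)
      have : C * Real.exp (-γ * (k + j : ℕ)) ≤ C * t := by gcongr
      gcongr
      linarith
    have h3 : m (k + j) * (m k - C * t) ≤ m (k + j) * μ.real (E k) := by
      have := h.le_measureReal k
      have : C * Real.exp (-γ * k) ≤ C * t := by gcongr
      gcongr
      linarith
    have h4 : C * Real.exp (-γ * k) ≤ C * t := by gcongr
    have h5 : m k * (C * t) ≤ C * t := mul_le_of_le_one_left (by positivity) hmk1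
    have h6 : m (k + j) * (C * t) ≤ C * t := mul_le_of_le_one_left (by positivity) hml1
    have h7 : C * m (k + j) * Real.exp (-γ * j)
        ≤ (3 * C + 1) * ((m k + m (k + j)) * Real.exp (-γ * j)) := by
      rw [mul_assoc]
      gcongr
      · linarith
      · linarith
    linarith

theorem IsQuasiIndependent.integral_sq_sum_le (h : IsQuasiIndependent μ m E C γ) (hC : 0 < C)
    (hm0 : ∀ k, 0 ≤ m k) (hm1 : ∀ k, m k ≤ 1) {G : ℝ}
    (hG : ∀ (k : ℕ) (F : Finset ℕ), ∑ l ∈ F, Real.exp (-γ * |(k : ℝ) - l|) ≤ G)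
    {t : ℝ} {F : Finset ℕ} (ht : ∀ k ∈ F, Real.exp (-γ * k) ≤ t) :
    ∫ x, (∑ k ∈ F, ((E k).indicator (fun _ => (1 : ℝ)) x - m k)) ^ 2 ∂μ
      ≤ (3 * C + 1) * ((F.card : ℝ) ^ 2 * t + 2 * G * ∑ k ∈ F, m k) := by
  simp_rw [sq, Finset.sum_mul_sum]
  rw [integral_finsetSum _ fun k _ => integrable_finsetSum _ fun l _ =>
    integrable_centered_indicator_mul (h.measurableSet k) (h.measurableSet l) _ _]
  have h1 : ∀ k ∈ F, ∫ x, ∑ l ∈ F, ((E k).indicator (fun _ => (1 : ℝ)) x - m k)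
        * ((E l).indicator (fun _ => (1 : ℝ)) x - m l) ∂μ
      ≤ ∑ l ∈ F, (3 * C + 1) * (t + (m k + m l) * Real.exp (-γ * |(k : ℝ) - l|)) := by
    intro k hk
    rw [integral_finsetSum _ fun l _ =>
      integrable_centered_indicator_mul (h.measurableSet k) (h.measurableSet l) _ _]
    exact Finset.sum_le_sum fun l hl => h.covariance_le hC hm0 hm1 (ht k hk) (ht l hl)
  refine (Finset.sum_le_sum h1).trans ?_
  have h0 : 0 ≤ 3 * C + 1 := by positivity
  generalize 3 * C + 1 = A at h0 ⊢
  simp_rw [← Finset.mul_sum, Finset.sum_add_distrib, add_mul, Finset.sum_add_distrib]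
  have h2 : ∑ k ∈ F, ∑ l ∈ F, m k * Real.exp (-γ * |(k : ℝ) - l|) ≤ G * ∑ k ∈ F, m k := by
    rw [Finset.mul_sum]
    refine Finset.sum_le_sum fun k _ => ?_
    rw [← Finset.mul_sum, mul_comm]
    exact mul_le_mul_of_nonneg_right (hG k F) (hm0 k)
  have h3 : ∑ k ∈ F, ∑ l ∈ F, m l * Real.exp (-γ * |(k : ℝ) - l|) ≤ G * ∑ k ∈ F, m k := by
    rw [Finset.sum_comm]
    simpa only [abs_sub_comm] using h2
  simp only [Finset.sum_const, nsmul_eq_mul]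
  refine mul_le_mul_of_nonneg_left ?_ h0
  linarith

/-- The first `O(log n)` events are estimated trivially; for the later ones the errors
`exp (-γ k)` are at most `n⁻²` and are negligible even after summation over all pairs. -/
theorem IsQuasiIndependent.exists_integral_sq_le (hC : 0 < C) (hγ : 0 < γ) :
    ∃ D : ℝ, 0 < D ∧ ∀ (m : ℕ → ℝ) (E : ℕ → Set (Set.Icc (0 : ℝ) 1)),
      (∀ k, 0 ≤ m k) → (∀ k, m k ≤ 1) → IsQuasiIndependent μ m E C γ → ∀ n : ℕ, 0 < n →
      ∫ x, (∑ k ∈ Finset.Icc 1 n, ((E k).indicator (fun _ => (1 : ℝ)) x - m k)) ^ 2 ∂μ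
        ≤ D * (∑ k ∈ Finset.Icc 1 n, m k + 1 + Real.log n ^ 2) := by
  obtain ⟨G, hG0, hG⟩ := exists_sum_exp_abs_sub_le hγ
  refine ⟨2 * ((3 * C + 1) * (1 + 2 * G) + (2 / γ) ^ 2), by positivity,
    fun m E hm0 hm1 h n hn => ?_⟩
  have hn' : (0 : ℝ) < n := Nat.cast_pos.2 hn
  have hlog : 0 ≤ Real.log n := Real.log_natCast_nonneg n
  set p : ℝ := 2 / γ * Real.log n with hp
  have hp0 : 0 ≤ p := by positivity
  set F := (Finset.Icc 1 n).filter fun k : ℕ => ¬ (k : ℝ) ≤ p with hF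
  set F' := (Finset.Icc 1 n).filter fun k : ℕ => (k : ℝ) ≤ p with hF'
  set Z : ℕ → Set.Icc (0 : ℝ) 1 → ℝ := fun k x => (E k).indicator (fun _ => (1 : ℝ)) x - m k
    with hZ
  have hZ1 : ∀ k x, |Z k x| ≤ 1 := fun k x => by
    have := hm0 k
    have := hm1 k
    rw [abs_le]
    by_cases hx : x ∈ E k <;> simp only [hZ, Set.indicator_of_mem, Set.indicator_of_notMem, hx,
      not_false_iff] <;> constructor <;> linarith
  have hF'card : (F'.card : ℝ) ≤ p := by
    have hsub : F' ⊆ Finset.Icc 1 ⌊p⌋₊ := fun k hk => by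
      rw [hF', Finset.mem_filter, Finset.mem_Icc] at hk
      exact Finset.mem_Icc.2 ⟨hk.1.1, Nat.le_floor hk.2⟩
    have h1 := Finset.card_le_card hsub
    rw [Nat.card_Icc, Nat.add_sub_cancel] at h1
    exact (Nat.cast_le.2 h1).trans (Nat.floor_le hp0)
  have hsq' : ∀ x, (∑ k ∈ F', Z k x) ^ 2 ≤ p ^ 2 := fun x => by
    refine sq_le_sq' ?_ ?_ <;>
    · have h1 : |∑ k ∈ F', Z k x| ≤ p := by
        refine (Finset.abs_sum_le_sum_abs _ _).trans ?_
        refine (Finset.sum_le_sum fun k _ => hZ1 k x).trans ?_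
        simpa using hF'card
      linarith [(abs_le.1 h1).1, (abs_le.1 h1).2]
  have hFcard : (F.card : ℝ) ≤ n := by
    have h1 := Finset.card_filter_le (Finset.Icc 1 n) fun k : ℕ => ¬ (k : ℝ) ≤ p
    rw [Nat.card_Icc, Nat.add_sub_cancel] at h1
    exact Nat.cast_le.2 h1
  have ht : ∀ k ∈ F, Real.exp (-γ * k) ≤ ((n : ℝ) ^ 2)⁻¹ := fun k hk => by
    have hk' : p < k := not_le.1 (Finset.mem_filter.1 hk).2
    have h1 : 2 * Real.log n ≤ γ * k := by
      have h2 : γ * p = 2 * Real.log n := by rw [hp]; field_simp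
      rw [← h2]
      gcongr
    rw [← Real.exp_log (by positivity : (0 : ℝ) < ((n : ℝ) ^ 2)⁻¹), Real.log_inv, Real.log_pow]
    push_cast
    gcongr
    linarith
  have hint : ∀ H : Finset ℕ, Integrable (fun x => (∑ k ∈ H, Z k x) ^ 2) μ := fun H => by
    simp_rw [sq, Finset.sum_mul_sum]
    exact integrable_finsetSum _ fun k _ => integrable_finsetSum _ fun l _ =>
      integrable_centered_indicator_mul (h.measurableSet k) (h.measurableSet l) _ _
  have hmain := h.integral_sq_sum_le hC hm0 hm1 hG ht
  have hsum : ∑ k ∈ F, m k ≤ ∑ k ∈ Finset.Icc 1 n, m k :=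
    Finset.sum_le_sum_of_subset_of_nonneg (Finset.filter_subset _ _) fun k _ _ => hm0 k
  have hS0 : 0 ≤ ∑ k ∈ Finset.Icc 1 n, m k := Finset.sum_nonneg fun k _ => hm0 k
  have hcard2 : (F.card : ℝ) ^ 2 * ((n : ℝ) ^ 2)⁻¹ ≤ 1 := by
    rw [← div_eq_mul_inv]
    exact div_le_one_of_le₀ (by gcongr) (by positivity)
  calc ∫ x, (∑ k ∈ Finset.Icc 1 n, Z k x) ^ 2 ∂μ
      ≤ ∫ x, (2 * p ^ 2 + 2 * (∑ k ∈ F, Z k x) ^ 2) ∂μ := by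
        refine integral_mono (hint _) ((integrable_const _).add ((hint F).const_mul 2)) fun x => ?_
        dsimp only
        rw [← Finset.sum_filter_add_sum_filter_not (Finset.Icc 1 n) fun k : ℕ => (k : ℝ) ≤ p]
        have h1 := hsq' x
        have h2 := add_sq_le (a := ∑ k ∈ F', Z k x) (b := ∑ k ∈ F, Z k x)
        linarith
    _ = 2 * p ^ 2 + 2 * ∫ x, (∑ k ∈ F, Z k x) ^ 2 ∂μ := by
        rw [integral_add (integrable_const _) ((hint F).const_mul 2)]
        simp [integral_const_mul]
    _ ≤ 2 * p ^ 2 + 2 * ((3 * C + 1) * (1 + 2 * G * ∑ k ∈ Finset.Icc 1 n, m k)) := by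
        refine add_le_add le_rfl (mul_le_mul_of_nonneg_left (hmain.trans ?_) zero_le_two)
        gcongr
    _ ≤ _ := by
        rw [hp, mul_pow]
        have h1 : 0 ≤ (2 / γ) ^ 2 := by positivity
        have h2 : 0 ≤ (3 * C + 1) * G := by positivity
        have h3 : 0 ≤ 3 * C + 1 := by positivity
        have h4 : 0 ≤ Real.log n ^ 2 := by positivity
        nlinarith [mul_nonneg h1 hS0, mul_nonneg h2 h4, mul_nonneg h3 hS0, mul_nonneg h3 h4]

end SecondMoment

/-! ### A strong law from a second moment bound -/

/-- Interpolation between the indices at which the normalising sequence `S` reaches the squares: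
consecutive squares have asymptotic ratio one, so monotonicity of `X` and `S` suffices. -/
theorem tendsto_div_of_monotone_of_tendsto_sq {X S : ℕ → ℝ} (hX : Monotone X) (hX0 : ∀ n, 0 ≤ X n)
    (hS0 : ∀ n, 0 ≤ S n) (hS : Tendsto S atTop atTop) {a : ℕ → ℕ}
    (ha : ∀ j n : ℕ, a j ≤ n ↔ (j : ℝ) ^ 2 ≤ S n)
    (hlim : Tendsto (fun j : ℕ => X (a j) / (j : ℝ) ^ 2) atTop (𝓝 1)) :
    Tendsto (fun n => X n / S n) atTop (𝓝 1) := by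
  set q : ℕ → ℕ := fun n => ⌊√(S n)⌋₊ with hq
  have hqtop : Tendsto q atTop atTop :=
    tendsto_nat_floor_atTop.comp (Real.tendsto_sqrt_atTop.comp hS)
  have hq1 : ∀ n, (q n : ℝ) ^ 2 ≤ S n := fun n => by
    have h1 : (q n : ℝ) ≤ √(S n) := Nat.floor_le (Real.sqrt_nonneg _)
    calc (q n : ℝ) ^ 2 ≤ √(S n) ^ 2 := by gcongr
      _ = S n := Real.sq_sqrt (hS0 n)
  have hq2 : ∀ n, S n < ((q n + 1 : ℕ) : ℝ) ^ 2 := fun n => by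
    have h1 : √(S n) < (q n : ℝ) + 1 := Nat.lt_floor_add_one _
    calc S n = √(S n) ^ 2 := (Real.sq_sqrt (hS0 n)).symm
      _ < _ := by push_cast; gcongr
  have hratio : Tendsto (fun j : ℕ => ((j : ℝ) / (j + 1)) ^ 2) atTop (𝓝 1) := by
    simpa using (tendsto_natCast_div_add_atTop (1 : ℝ)).pow 2
  have hlow : Tendsto (fun j : ℕ => X (a j) / (j : ℝ) ^ 2 * ((j : ℝ) / (j + 1)) ^ 2) atTop
      (𝓝 1) := by simpa using hlim.mul hratio
  have hupp : Tendsto (fun j : ℕ => X (a (j + 1)) / ((j + 1 : ℕ) : ℝ) ^ 2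
      * (((j : ℝ) / (j + 1)) ^ 2)⁻¹) atTop (𝓝 1) := by
    simpa using (hlim.comp (tendsto_add_atTop_nat 1)).mul (hratio.inv₀ one_ne_zero)
  refine tendsto_of_tendsto_of_tendsto_of_le_of_le' (hlow.comp hqtop) (hupp.comp hqtop) ?_ ?_
  all_goals
    filter_upwards [hqtop.eventually_ge_atTop 1] with n hn
    have hqpos : (0 : ℝ) < q n := by exact_mod_cast hn
    have hSpos : 0 < S n := lt_of_lt_of_le (by positivity) (hq1 n)
    simp only [Function.comp]
  · have h1 : X (a (q n)) ≤ X n := hX ((ha _ _).2 (hq1 n))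
    have h2 := (hq2 n).le
    push_cast at h2
    calc _ = X (a (q n)) / ((q n : ℝ) + 1) ^ 2 := by field_simp
      _ ≤ X n / S n := div_le_div₀ (hX0 n) h1 hSpos h2
  · have h1 : X n ≤ X (a (q n + 1)) := hX (le_of_not_ge fun hle =>
      (hq2 n).not_ge ((ha _ _).1 hle))
    calc X n / S n ≤ X (a (q n + 1)) / (q n : ℝ) ^ 2 :=
          div_le_div₀ (hX0 _) h1 (by positivity) (hq1 n)
      _ = _ := by push_cast; field_simp

theorem ae_tendsto_zero_of_integral_le_summable {Ω : Type*} [MeasurableSpace Ω] {μ : Measure Ω}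
    {Y : ℕ → Ω → ℝ} (hY0 : ∀ j x, 0 ≤ Y j x) (hY : ∀ j, Integrable (Y j) μ) {b : ℕ → ℝ}
    (hb : Summable b) (hYb : ∀ᶠ j in atTop, ∫ x, Y j x ∂μ ≤ b j) :
    ∀ᵐ x ∂μ, Tendsto (fun j => Y j x) atTop (𝓝 0) := by
  have hI0 : ∀ j, 0 ≤ ∫ x, Y j x ∂μ := fun j => integral_nonneg (hY0 j)
  have hsum : Summable fun j => ∫ x, Y j x ∂μ := by
    refine hb.of_norm_bounded_eventually_nat (hYb.mono fun j hj => ?_)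
    rwa [Real.norm_of_nonneg (hI0 j)]
  have hlt : ∫⁻ x, ∑' j, ENNReal.ofReal (Y j x) ∂μ ≠ ⊤ := by
    rw [lintegral_tsum fun j => (hY j).aestronglyMeasurable.aemeasurable.ennreal_ofReal]
    have h1 : ∀ j, ∫⁻ x, ENNReal.ofReal (Y j x) ∂μ = ENNReal.ofReal (∫ x, Y j x ∂μ) := fun j =>
      (ofReal_integral_eq_lintegral_ofReal (hY j) (ae_of_all _ (hY0 j))).symm
    simp_rw [h1]
    exact hsum.tsum_ofReal_ne_top
  filter_upwards [ae_lt_top' (AEMeasurable.tsum fun j =>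
    (hY j).aestronglyMeasurable.aemeasurable.ennreal_ofReal) hlt] with x hx
  have h1 := ENNReal.tendsto_atTop_zero_of_tsum_ne_top hx.ne
  have h2 := (ENNReal.tendsto_toReal ENNReal.zero_ne_top).comp h1
  simpa [Function.comp_def, ENNReal.toReal_ofReal (hY0 _ x)] using h2

/-- If the variance of the number of events among the first `n` is of the order of its mean, then
this number is asymptotic to its mean almost surely. -/
theorem ae_tendsto_sum_indicator_div {Ω : Type*} [MeasurableSpace Ω] {μ : Measure Ω}
    [IsProbabilityMeasure μ] {E : ℕ → Set Ω} (hE : ∀ k, MeasurableSet (E k)) {m : ℕ → ℝ}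
    (hm0 : ∀ k, 0 ≤ m k) (hm1 : ∀ k, m k ≤ 1)
    (hS : Tendsto (fun n => ∑ k ∈ Finset.Icc 1 n, m k) atTop atTop) {D : ℝ}
    (hvar : ∀ᶠ n : ℕ in atTop,
      ∫ x, (∑ k ∈ Finset.Icc 1 n, ((E k).indicator (fun _ => (1 : ℝ)) x - m k)) ^ 2 ∂μ
        ≤ D * ∑ k ∈ Finset.Icc 1 n, m k) :
    ∀ᵐ x ∂μ, Tendsto (fun n => (∑ k ∈ Finset.Icc 1 n, (E k).indicator (fun _ => (1 : ℝ)) x)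
      / ∑ k ∈ Finset.Icc 1 n, m k) atTop (𝓝 1) := by
  classical
  set S : ℕ → ℝ := fun n => ∑ k ∈ Finset.Icc 1 n, m k with hSdef
  set X : ℕ → Ω → ℝ := fun n x => ∑ k ∈ Finset.Icc 1 n, (E k).indicator (fun _ => (1 : ℝ)) x
    with hXdef
  have hind : ∀ k x, 0 ≤ (E k).indicator (fun _ => (1 : ℝ)) x := fun k x =>
    Set.indicator_nonneg (fun _ _ => zero_le_one) x
  have hSmono : Monotone S := fun a b hab =>
    Finset.sum_le_sum_of_subset_of_nonneg (Finset.Icc_subset_Icc_right hab) fun k _ _ => hm0 k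
  have hS0 : ∀ n, 0 ≤ S n := fun n => Finset.sum_nonneg fun k _ => hm0 k
  have hSsucc : ∀ n, S (n + 1) = S n + m (n + 1) := fun n =>
    Finset.sum_Icc_succ_top (by omega) _
  have hSle : ∀ n : ℕ, S n ≤ n := fun n => by
    refine (Finset.sum_le_sum fun k _ => hm1 k).trans ?_
    simp
  have hex : ∀ j : ℕ, ∃ n, (j : ℝ) ^ 2 ≤ S n := fun j => (hS.eventually_ge_atTop _).exists
  set a : ℕ → ℕ := fun j => Nat.find (hex j) with hadef
  have haspec : ∀ j : ℕ, (j : ℝ) ^ 2 ≤ S (a j) := fun j => Nat.find_spec (hex j)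
  have ha : ∀ j n : ℕ, a j ≤ n ↔ (j : ℝ) ^ 2 ≤ S n := fun j n =>
    ⟨fun h => (haspec j).trans (hSmono h), fun h => Nat.find_min' (hex j) h⟩
  have haupp : ∀ j, S (a j) ≤ (j : ℝ) ^ 2 + 1 := fun j => by
    rcases Nat.eq_zero_or_eq_succ_pred (a j) with h0 | hsucc
    · rw [h0]
      have : S 0 = 0 := by simp [hSdef]
      rw [this]; positivity
    · have hlt : ¬ a j ≤ (a j).pred := by
        rw [hsucc, Nat.pred_succ]
        omega
      rw [ha, not_le] at hlt
      have h1 := hSsucc (a j).pred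
      rw [← Nat.succ_eq_add_one, ← hsucc] at h1
      linarith [hm1 (a j)]
  have hatop : Tendsto a atTop atTop := by
    refine tendsto_atTop_mono (fun j => ?_) tendsto_id
    have h1 : (j : ℝ) ^ 2 ≤ (a j : ℝ) := (haspec j).trans (hSle _)
    have h2 : j ^ 2 ≤ a j := by exact_mod_cast h1
    exact (Nat.le_self_pow two_ne_zero j).trans h2
  have hXS : ∀ n x, ∑ k ∈ Finset.Icc 1 n, ((E k).indicator (fun _ => (1 : ℝ)) x - m k)
      = X n x - S n := fun n x => Finset.sum_sub_distrib _ _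
  simp_rw [hXS] at hvar
  have hXmeas : ∀ n, Measurable (X n) := fun n =>
    Finset.measurable_fun_sum _ fun k _ => measurable_const.indicator (hE k)
  have hXle : ∀ n x, X n x ≤ n := fun n x => by
    refine (Finset.sum_le_sum (g := fun _ => (1 : ℝ)) fun k _ => ?_).trans (by simp)
    exact Set.indicator_le_self' (fun _ _ => zero_le_one) x
  have hX0 : ∀ n x, 0 ≤ X n x := fun n x => Finset.sum_nonneg fun k _ => hind k x
  have hint : ∀ n, Integrable (fun x => (X n x - S n) ^ 2) μ := fun n => by
    refine Integrable.of_bound (((hXmeas n).sub_const _).pow_const 2).aestronglyMeasurable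
      ((n : ℝ) ^ 2) (ae_of_all _ fun x => ?_)
    rw [Real.norm_of_nonneg (sq_nonneg _)]
    refine sq_le_sq' ?_ ?_ <;> linarith [hXle n x, hX0 n x, hS0 n, hSle n]
  have hY : ∀ᵐ x ∂μ, Tendsto (fun j => ((X (a j) x - S (a j)) ^ 2 / S (a j) ^ 2)) atTop (𝓝 0) := by
    refine ae_tendsto_zero_of_integral_le_summable (b := fun j => |D| * (1 / (j : ℝ) ^ 2))
      (fun j x => by positivity) (fun j => (hint _).div_const _)
      ((Real.summable_one_div_nat_pow.2 one_lt_two).mul_left _) ?_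
    filter_upwards [hatop.eventually hvar, eventually_ge_atTop 1] with j hj hj1
    have hjpos : (0 : ℝ) < (j : ℝ) ^ 2 := by
      have : (0 : ℝ) < j := by exact_mod_cast hj1
      positivity
    have hSpos : 0 < S (a j) := hjpos.trans_le (haspec j)
    rw [integral_div]
    calc _ ≤ D * S (a j) / S (a j) ^ 2 := by gcongr
      _ = D * (1 / S (a j)) := by field_simp
      _ ≤ |D| * (1 / S (a j)) := by gcongr; exact le_abs_self D
      _ ≤ |D| * (1 / (j : ℝ) ^ 2) := by gcongr; exact haspec j
  have hSj : Tendsto (fun j : ℕ => S (a j) / (j : ℝ) ^ 2) atTop (𝓝 1) := by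
    have hupp : Tendsto (fun j : ℕ => 1 + ((j : ℝ) ^ 2)⁻¹) atTop (𝓝 1) := by
      have h1 : Tendsto (fun j : ℕ => (j : ℝ) ^ 2) atTop atTop :=
        (tendsto_pow_atTop two_ne_zero).comp tendsto_natCast_atTop_atTop
      simpa using h1.inv_tendsto_atTop.const_add 1
    refine tendsto_of_tendsto_of_tendsto_of_le_of_le' tendsto_const_nhds hupp ?_ ?_
    all_goals
      filter_upwards [eventually_ge_atTop 1] with j hj1
      have hj0 : (0 : ℝ) < j := by exact_mod_cast hj1
    · rw [le_div_iff₀ (by positivity)]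
      linarith [haspec j]
    · rw [div_le_iff₀ (by positivity), add_mul, inv_mul_cancel₀ (by positivity)]
      linarith [haupp j]
  filter_upwards [hY] with x hx
  refine tendsto_div_of_monotone_of_tendsto_sq (X := fun n => X n x) ?_ (fun n => hX0 n x) hS0 hS
    ha ?_
  · exact fun p q hpq => Finset.sum_le_sum_of_subset_of_nonneg (Finset.Icc_subset_Icc_right hpq)
      fun k _ _ => hind k x
  · have h1 : Tendsto (fun j => (X (a j) x - S (a j)) / S (a j)) atTop (𝓝 0) := by
      rw [tendsto_zero_iff_abs_tendsto_zero]
      have h2 := (Real.continuous_sqrt.tendsto 0).comp hx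
      simpa [Function.comp_def, ← div_pow, Real.sqrt_sq_eq_abs] using h2
    have h3 := (h1.add_const 1).mul hSj
    rw [zero_add, one_mul] at h3
    refine h3.congr' ?_
    filter_upwards [eventually_ge_atTop 1] with j hj1
    have hj0 : (0 : ℝ) < j := by exact_mod_cast hj1
    have hSpos : 0 < S (a j) := lt_of_lt_of_le (by positivity) (haspec j)
    field_simp
    ring

/-! ### Recurrence events with prescribed measures -/

/-- A lower bound of order `(log k) ^ 4 / k` on the terms is far more than is needed to dominate
the increments of `(log n) ^ 2`. -/
theorem exists_log_sq_le_sum {m : ℕ → ℝ} {ε : ℝ} (hε : 0 < ε)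
    (hm : ∀ᶠ k : ℕ in atTop, Real.log (k : ℝ) ^ (4 + ε) / (k : ℝ) ≤ m k) :
    ∃ B : ℝ, ∀ᶠ n : ℕ in atTop, Real.log n ^ 2 ≤ ∑ k ∈ Finset.Icc 1 n, m k + B := by
  have hlog : ∀ᶠ k : ℕ in atTop, 4 ≤ Real.log k :=
    (Real.tendsto_log_atTop.comp tendsto_natCast_atTop_atTop).eventually_ge_atTop 4
  obtain ⟨k₀, hk₀⟩ := eventually_atTop.1 (hm.and (hlog.and (eventually_ge_atTop 1)))
  refine ⟨Real.log k₀ ^ 2 - ∑ k ∈ Finset.Icc 1 k₀, m k, eventually_atTop.2 ⟨k₀, fun n hn => ?_⟩⟩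
  induction n, hn using Nat.le_induction with
  | base => linarith
  | succ n hn ih =>
    obtain ⟨hm', hlog', -⟩ := hk₀ (n + 1) (by omega)
    have hn1 : (1 : ℝ) ≤ n := by exact_mod_cast (hk₀ n hn).2.2
    rw [Finset.sum_Icc_succ_top (by omega)]
    set u := Real.log ((n + 1 : ℕ) : ℝ) with hu
    have hv : 0 ≤ Real.log n := Real.log_nonneg hn1
    have hvu : Real.log n ≤ u := Real.log_le_log (by linarith) (by push_cast; linarith)
    have hdiff : u - Real.log n ≤ 2 / (n + 1) := by
      rw [hu, ← Real.log_div (by positivity) (by positivity)]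
      refine (Real.log_le_sub_one_of_pos (by positivity)).trans ?_
      push_cast
      rw [div_sub_one (by positivity), div_le_div_iff₀ (by positivity) (by positivity)]
      linarith
    have hpow : 4 * u ≤ u ^ (4 + ε) := by
      calc 4 * u ≤ u * u := by gcongr
        _ = u ^ (2 : ℝ) := by rw [Real.rpow_two, sq]
        _ ≤ u ^ (4 + ε) := Real.rpow_le_rpow_of_exponent_le (by linarith) (by linarith)
    have hinc : u ^ 2 - Real.log n ^ 2 ≤ m (n + 1) := by
      calc u ^ 2 - Real.log n ^ 2 = (u - Real.log n) * (u + Real.log n) := by ring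
        _ ≤ 2 / (n + 1) * (2 * u) := by
            gcongr
            linarith
        _ = 4 * u / (n + 1) := by ring
        _ ≤ u ^ (4 + ε) / (n + 1) := by gcongr
        _ ≤ m (n + 1) := by exact_mod_cast hm'
    linarith

theorem tendsto_sum_atTop_of_log_sq_le {S : ℕ → ℝ} {B : ℝ}
    (h : ∀ᶠ n : ℕ in atTop, Real.log n ^ 2 ≤ S n + B) : Tendsto S atTop atTop := by
  have h1 : Tendsto (fun n : ℕ => Real.log n ^ 2 - B) atTop atTop :=
    tendsto_atTop_add_const_right _ _ ((tendsto_pow_atTop two_ne_zero).comp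
      (Real.tendsto_log_atTop.comp tendsto_natCast_atTop_atTop))
  exact tendsto_atTop_mono' _ (h.mono fun n hn => by linarith) h1

theorem IsRecurrenceEvents.ae_tendsto {T : Set.Icc (0 : ℝ) 1 → Set.Icc (0 : ℝ) 1}
    {μ : Measure (Set.Icc (0 : ℝ) 1)} [IsProbabilityMeasure μ] (hT : Measurable T)
    (hdecay : ExpDecayCorrelations T μ)
    {b s : ℝ} (hb : 0 < b) (hs : 0 < s) (hg : BallGrowth μ b s) {m : ℕ → ℝ}
    (hm0 : ∀ k, 0 ≤ m k) (hm1 : ∀ k, m k ≤ 1) {B : ℝ}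
    (hlog : ∀ᶠ n : ℕ in atTop, Real.log n ^ 2 ≤ ∑ k ∈ Finset.Icc 1 n, m k + B)
    {E : ℕ → Set (Set.Icc (0 : ℝ) 1)} (hE : IsRecurrenceEvents T μ m E) :
    ∀ᵐ x ∂μ, Tendsto (fun n => (∑ k ∈ Finset.Icc 1 n, (E k).indicator (fun _ => (1 : ℝ)) x)
      / ∑ k ∈ Finset.Icc 1 n, m k) atTop (𝓝 1) := by
  obtain ⟨c, τ, hc, hτ, hmix⟩ := hdecay.exists_expMixingSets hT
  obtain ⟨C, γ, hC, hγ, hQ⟩ := exists_isQuasiIndependent hT hc hτ hmix hb hs hg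
  obtain ⟨D, hD, hvar⟩ := IsQuasiIndependent.exists_integral_sq_le (μ := μ) hC hγ
  have hS := tendsto_sum_atTop_of_log_sq_le hlog
  refine ae_tendsto_sum_indicator_div hE.measurableSet hm0 hm1 hS (D := 3 * D) ?_
  filter_upwards [hlog, hS.eventually_ge_atTop (1 + B), eventually_gt_atTop 0] with n h1 h2 h3
  refine (hvar m E hm0 hm1 (hQ m E hm0 hm1 hE) n h3).trans ?_
  rw [mul_comm 3 D, mul_assoc]
  gcongr
  linarith

/-! ### Comparison of sums -/

theorem exists_sum_add_le_sum {u w : ℕ → ℝ} {k₀ : ℕ} (h : ∀ k, k₀ ≤ k → u k ≤ w k) :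
    ∃ c : ℝ, ∀ n, k₀ ≤ n → ∑ k ∈ Finset.Icc 1 n, u k + c ≤ ∑ k ∈ Finset.Icc 1 n, w k := by
  refine ⟨∑ k ∈ Finset.Icc 1 k₀, w k - ∑ k ∈ Finset.Icc 1 k₀, u k, fun n hn => ?_⟩
  induction n, hn using Nat.le_induction with
  | base => linarith
  | succ n hn ih =>
    rw [Finset.sum_Icc_succ_top (by omega), Finset.sum_Icc_succ_top (by omega)]
    linarith [h (n + 1) (by omega)]

theorem tendsto_sum_div_of_eventually_le {u v w S : ℕ → ℝ} {k₀ : ℕ}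
    (huw : ∀ k, k₀ ≤ k → u k ≤ w k) (hwv : ∀ k, k₀ ≤ k → w k ≤ v k)
    (hS : Tendsto S atTop atTop)
    (hu : Tendsto (fun n => (∑ k ∈ Finset.Icc 1 n, u k) / S n) atTop (𝓝 1))
    (hv : Tendsto (fun n => (∑ k ∈ Finset.Icc 1 n, v k) / S n) atTop (𝓝 1)) :
    Tendsto (fun n => (∑ k ∈ Finset.Icc 1 n, w k) / S n) atTop (𝓝 1) := by
  obtain ⟨c, hc⟩ := exists_sum_add_le_sum huw
  obtain ⟨d, hd⟩ := exists_sum_add_le_sum hwv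
  have hu' := hu.add (hS.const_div_atTop c)
  have hv' := hv.sub (hS.const_div_atTop d)
  rw [add_zero] at hu'
  rw [sub_zero] at hv'
  refine tendsto_of_tendsto_of_tendsto_of_le_of_le' hu' hv' ?_ ?_
  all_goals filter_upwards [eventually_ge_atTop k₀, hS.eventually_gt_atTop 0] with n hn hSn
  · rw [← add_div]
    gcongr
    exact hc n hn
  · rw [← sub_div]
    gcongr
    linarith [hd n hn]

/-! ### Balls with arbitrary radii -/

theorem BallGrowth.measurable_ballMass_iterate {T : Set.Icc (0 : ℝ) 1 → Set.Icc (0 : ℝ) 1}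
    {μ : Measure (Set.Icc (0 : ℝ) 1)} [IsProbabilityMeasure μ] {b s : ℝ} (hT : Measurable T)
    (hb : 0 ≤ b) (hs : 0 < s) (hg : BallGrowth μ b s) (k : ℕ) :
    Measurable fun x => ballMass μ x (T^[k] x) :=
  (hg.continuous_ballMass hb hs).measurable2 (c := fun x y => ballMass μ x y) measurable_id
    (hT.iterate k)

theorem isRecurrenceEvents_lt {T : Set.Icc (0 : ℝ) 1 → Set.Icc (0 : ℝ) 1}
    {μ : Measure (Set.Icc (0 : ℝ) 1)} [IsProbabilityMeasure μ] {b s : ℝ} (hT : Measurable T)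
    (hb : 0 ≤ b) (hs : 0 < s) (hg : BallGrowth μ b s) (m : ℕ → ℝ) :
    IsRecurrenceEvents T μ m fun k => {x | ballMass μ x (T^[k] x) < m k} where
  measurableSet k :=
    measurableSet_lt (hg.measurable_ballMass_iterate hT hb hs k) measurable_const
  mem_of_lt k x h := by
    change ballMass μ x (T^[k] x) < m k
    exact h
  le_of_mem k x hx := by
    have h : ballMass μ x (T^[k] x) < m k := hx
    exact h.le

theorem isRecurrenceEvents_le {T : Set.Icc (0 : ℝ) 1 → Set.Icc (0 : ℝ) 1}
    {μ : Measure (Set.Icc (0 : ℝ) 1)} [IsProbabilityMeasure μ] {b s : ℝ} (hT : Measurable T)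
    (hb : 0 ≤ b) (hs : 0 < s) (hg : BallGrowth μ b s) (m : ℕ → ℝ) :
    IsRecurrenceEvents T μ m fun k => {x | ballMass μ x (T^[k] x) ≤ m k} where
  measurableSet k :=
    measurableSet_le (hg.measurable_ballMass_iterate hT hb hs k) measurable_const
  mem_of_lt k x h := by
    change ballMass μ x (T^[k] x) ≤ m k
    exact h.le
  le_of_mem k x hx := by
    have h : ballMass μ x (T^[k] x) ≤ m k := hx
    exact h

/-- Whether `y` lies in a ball of measure `t` centred at `x` is decided by `ballMass μ x y`, except
when the latter is equal to `t`. -/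
theorem indicator_ballMass_le_indicator_ball {μ : Measure (Set.Icc (0 : ℝ) 1)}
    [IsProbabilityMeasure μ] {x : Set.Icc (0 : ℝ) 1} {ρ t : ℝ}
    (hρ : μ.real (Metric.ball x ρ) = t) (S : Set.Icc (0 : ℝ) 1 → Set.Icc (0 : ℝ) 1) :
    {z | ballMass μ z (S z) < t}.indicator (fun _ => (1 : ℝ)) x
        ≤ (Metric.ball x ρ).indicator (fun _ => (1 : ℝ)) (S x) ∧
      (Metric.ball x ρ).indicator (fun _ => (1 : ℝ)) (S x)
        ≤ {z | ballMass μ z (S z) ≤ t}.indicator (fun _ => (1 : ℝ)) x := by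
  by_cases hmem : S x ∈ Metric.ball x ρ
  · have hin : x ∈ {z | ballMass μ z (S z) ≤ t} := by
      rw [Metric.mem_ball, dist_comm] at hmem
      change ballMass μ x (S x) ≤ t
      rw [← hρ]
      exact measureReal_mono (Metric.ball_subset_ball hmem.le)
    rw [Set.indicator_of_mem hmem, Set.indicator_of_mem hin]
    exact ⟨Set.indicator_le_self' (fun _ _ => zero_le_one) x, le_rfl⟩
  · have hnot : x ∉ {z | ballMass μ z (S z) < t} := fun hlt => by
      rw [Metric.mem_ball, dist_comm, not_lt] at hmem
      have h1 : t ≤ ballMass μ x (S x) := by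
        rw [← hρ]
        exact measureReal_mono (Metric.ball_subset_ball hmem)
      exact absurd hlt (not_lt.2 h1)
    rw [Set.indicator_of_notMem hnot, Set.indicator_of_notMem hmem]
    exact ⟨le_rfl, Set.indicator_nonneg (fun _ _ => zero_le_one) x⟩

end

theorem mainTheorem1
    (T : Set.Icc (0 : ℝ) 1 → Set.Icc (0 : ℝ) 1)
    (μ : Measure (Set.Icc (0 : ℝ) 1)) [IsProbabilityMeasure μ]
    (hT : MeasurePreserving T μ μ)
    (hdecay : ExpDecayCorrelations T μ)
    (hball : ∃ c s : ℝ, 0 < c ∧ 0 < s ∧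
      ∀ (x : Set.Icc (0 : ℝ) 1) (r : ℝ), 0 < r → μ.real (Metric.ball x r) ≤ c * r ^ s)
    (m : ℕ → ℝ)
    (hm : ∃ ε : ℝ, 0 < ε ∧
      ∀ᶠ k : ℕ in atTop, Real.log (k : ℝ) ^ (4 + ε) / (k : ℝ) ≤ m k)
    (hreg : Tendsto
      (fun ρ : ℝ => limsup (fun k : ℕ => ((m k / m ⌊ρ * (k : ℝ)⌋₊ : ℝ) : EReal)) atTop)
      (𝓝[>] (1 : ℝ)) (𝓝 (1 : EReal)))
    (r : ℕ → Set.Icc (0 : ℝ) 1 → ℝ)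
    (hr : ∀ᶠ k : ℕ in atTop, ∀ x, μ.real (Metric.ball x (r k x)) = m k) :
    ∀ᵐ x ∂μ, Tendsto
      (fun n : ℕ =>
        (∑ k ∈ Finset.Icc 1 n,
          (Metric.ball x (r k x)).indicator (fun _ => (1 : ℝ)) (T^[k] x)) /
        ∑ k ∈ Finset.Icc 1 n, μ.real (Metric.ball x (r k x)))
      atTop (𝓝 1) := by
  obtain ⟨b, s, hb, hs, hg⟩ := hball
  obtain ⟨ε, hε, hm⟩ := hm
  replace hg : BallGrowth μ b s := hg
  obtain ⟨k₀, hk₀⟩ := eventually_atTop.1 hr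
  -- The finitely many terms on which nothing is assumed are replaced by zero.
  obtain ⟨m', hm'eq, hm'01⟩ : ∃ m' : ℕ → ℝ, (∀ k, k₀ ≤ k → m' k = m k) ∧
      ∀ k, 0 ≤ m' k ∧ m' k ≤ 1 := by
    refine ⟨fun k => if k₀ ≤ k then m k else 0, fun k hk => if_pos hk, fun k => ?_⟩
    dsimp only
    split_ifs with hk
    · rw [← hk₀ k hk ⟨0, by simp⟩]
      exact ⟨measureReal_nonneg, measureReal_le_one⟩
    · simp
  have hm' : ∀ᶠ k : ℕ in atTop, Real.log (k : ℝ) ^ (4 + ε) / (k : ℝ) ≤ m' k := by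
    filter_upwards [hm, eventually_ge_atTop k₀] with k h1 h2
    rwa [hm'eq k h2]
  obtain ⟨B, hlog⟩ := exists_log_sq_le_sum hε hm'
  have hS := tendsto_sum_atTop_of_log_sq_le hlog
  have hlim : ∀ {E : ℕ → Set (Set.Icc (0 : ℝ) 1)}, IsRecurrenceEvents T μ m' E →
      ∀ᵐ x ∂μ, Tendsto (fun n => (∑ k ∈ Finset.Icc 1 n, (E k).indicator (fun _ => (1 : ℝ)) x)
        / ∑ k ∈ Finset.Icc 1 n, m' k) atTop (𝓝 1) := fun hE =>
    hE.ae_tendsto hT.measurable hdecay hb hs hg (fun k => (hm'01 k).1) (fun k => (hm'01 k).2) hlog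
  filter_upwards [hlim (isRecurrenceEvents_lt hT.measurable hb.le hs hg m'),
    hlim (isRecurrenceEvents_le hT.measurable hb.le hs hg m')] with x hx1 hx2
  have hnum := tendsto_sum_div_of_eventually_le (k₀ := k₀)
    (w := fun k => (Metric.ball x (r k x)).indicator (fun _ => (1 : ℝ)) (T^[k] x))
    (fun k hk => (indicator_ballMass_le_indicator_ball ((hk₀ k hk x).trans (hm'eq k hk).symm) _).1)
    (fun k hk => (indicator_ballMass_le_indicator_ball ((hk₀ k hk x).trans (hm'eq k hk).symm) _).2)
    hS hx1 hx2
  have hself : Tendsto (fun n => (∑ k ∈ Finset.Icc 1 n, m' k) / ∑ k ∈ Finset.Icc 1 n, m' k)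
      atTop (𝓝 1) := by
    refine tendsto_const_nhds.congr' ?_
    filter_upwards [hS.eventually_gt_atTop 0] with n hn
    exact (div_self hn.ne').symm
  have hden := tendsto_sum_div_of_eventually_le (k₀ := k₀)
    (w := fun k => μ.real (Metric.ball x (r k x)))
    (fun k hk => ((hm'eq k hk).trans (hk₀ k hk x).symm).le)
    (fun k hk => ((hm'eq k hk).trans (hk₀ k hk x).symm).ge) hS hself hself
  have hdiv := hnum.div hden one_ne_zero
  rw [div_one] at hdiv
  refine hdiv.congr' ?_
  filter_upwards [hS.eventually_gt_atTop 0] with n hn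
  exact div_div_div_cancel_right₀ hn.ne' _ _
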